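/- Let $k$ be a field and let $(T,E)$ be the $3$-regular tree, with distance function $d$. For $z\in T$ let $\sigma^z:\mathbb Z^{(T)}\to\mathbb Z^{(T)}$ be the reflection with $(\sigma^z a)_z=-a_z+\sum_{\{w,z\}\in E}a_w$ and $(\sigma^z a)_w=a_w$ for $w\ne z$; for a vertex $x$ let $\Sigma^x$ (respectively $\underline\Sigma^x$) be the composition of all (commuting) $\sigma^z$ with $d(x,z)$ even (respectively odd). Writing $s(x)$ for the basis vector at $x$, put $s_0(x)=s(x)$, and $r_0(x,y)=s(x)+s(y)$ for $\{x,y\}\in E$; define $s_{t+1}(x)=\underline\Sigma^x s_t(x)$ and $r_{t+1}(x,y)=\underline\Sigma^x r_t(x,y)$ if $t$ is even, and $s_{t+1}(x)=\Sigma^x s_t(x)$ and $r_{t+1}(x,y)=\Sigma^x r_t(x,y)$ if $t$ is odd. Let $\Omega^x_t$ be the orientation of $(T,E)$ in which every vertex is a sink or a source and in which $x$ is a sink if $t$ is even and a source if $t$ is odd. Let $P_t(x)$ and $R_t(x,y)$ (for $\{x,y\}\in E$) be the indecomposable representations over $k$ of the quiver $(T,E,\Omega^x_t)$ with dimension vectors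 $s_t(x)$ and $r_t(x,y)$, respectively; such representations exist and are unique up to isomorphism. **Proposition 4.1.** Let $x\in T$ have the three (distinct) neighbours $y,y',y''$, let $t\ge1$ be an integer, and let $(T,E)$ carry the bipartite orientation in which $x$ is a sink if $t$ is even and a source if $t$ is odd. Then there are exact sequences of representations $$0\to P_{t-1}(y)\to P_t(x)\to R_t(x,y)\to 0,$$ $$0\to P_{t-1}(y')\to R_t(x,y)\to R_{t-1}(y'',x)\to 0,$$ and each is unique up to isomorphism: any two exact sequences with these terms are isomorphic as short exact sequences. Moreover they categorify the Fibonacci recursion $f_{n+1}=f_n+f_{n-1}$ ($f_0=0$, $f_1=1$) in the following sense: for a representation $M$ let $M_+=\sum_{z\text{ a sink}}\dim_k M_z$; then $P_{t-1}(y)_+=P_{t-1}(y')_+=f_{2t}$, $P_t(x)_+=f_{2t+2}$, $R_t(x,y)_+=f_{2t+1}$ and $R_{t-1}(y'',x)_+=f_{2t-1}$, so that the two sequences yield $f_{2t+2}=f_{2t}+f_{2t+1}$ and $f_{2t+1}=f_{2t}+f_{2t-1}$. -/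

import Mathlib

universe u v

namespace FibonacciModules

section Vectors

variable {V : Type v} (G : SimpleGraph V) [G.LocallyFinite]

open Classical in
/-- The reflection at the vertex `y`: it changes only the coordinate at `y`, which becomes
minus its old value plus the sum of the coordinates at the neighbours of `y`. -/
noncomputable def reflection (y : V) (a : V → ℤ) : V → ℤ :=
  Function.update a y (-a y + ∑ w ∈ G.neighborFinset y, a w)

/-- The composition of all reflections at vertices of even distance from `x`. In a tree two
such vertices are never neighbours, so these reflections commute and do not influence each
other; the coordinate of the composition at such a vertex `z` is the one given by the
reflection at `z` (see `foldr_reflection`). -/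
noncomputable def evenReflection (x : V) (a : V → ℤ) : V → ℤ := fun z =>
  if Even (G.dist x z) then reflection G z a z else a z

/-- The composition of all reflections at vertices of odd distance from `x`. -/
noncomputable def oddReflection (x : V) (a : V → ℤ) : V → ℤ := fun z =>
  if Odd (G.dist x z) then reflection G z a z else a z

open Classical in
/-- Composing the reflections at finitely many different, pairwise non-adjacent vertices
reflects all these coordinates simultaneously. -/
theorem foldr_reflection (a : V → ℤ) (l : List V) (hl : l.Nodup)
    (hadj : ∀ p ∈ l, ∀ q ∈ l, ¬ G.Adj p q) (z : V) :
    l.foldr (reflection G) a z = if z ∈ l then reflection G z a z else a z := by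
  induction l generalizing z with
  | nil => simp
  | cons y l ih =>
    have ih' := ih (List.nodup_cons.1 hl).2
      (fun p hp q hq => hadj p (List.mem_cons_of_mem _ hp) q (List.mem_cons_of_mem _ hq))
    have hy : y ∉ l := (List.nodup_cons.1 hl).1
    rw [List.foldr_cons]
    by_cases hz : z = y
    · subst hz
      have hs : ∑ w ∈ G.neighborFinset z, l.foldr (reflection G) a w =
          ∑ w ∈ G.neighborFinset z, a w := by
        refine Finset.sum_congr rfl fun w hw => ?_
        have hwl : w ∉ l := fun h =>
          hadj z List.mem_cons_self w (List.mem_cons_of_mem _ h) (by simpa using hw)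
        rw [ih', if_neg hwl]
      have h0 : l.foldr (reflection G) a z = a z := by rw [ih', if_neg hy]
      simp [reflection, hs, h0]
    · have h1 : reflection G y (l.foldr (reflection G) a) z = l.foldr (reflection G) a z := by
        simp [reflection, Function.update_of_ne hz]
      rw [h1, ih']
      simp [hz]

/-- From `a` at stage `t`, alternately apply the odd reflections (for even `t`) and the
even reflections (for odd `t`). -/
noncomputable def iterReflection (x : V) (a : V → ℤ) : ℕ → V → ℤ
  | 0 => a
  | t + 1 =>
    if Even t then oddReflection G x (iterReflection x a t)
    else evenReflection G x (iterReflection x a t)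

open Classical in
/-- The Fibonacci vector `s_t(x)`, starting with the basis vector `s_0(x) = s(x)`. -/
noncomputable def sVec (t : ℕ) (x : V) : V → ℤ :=
  iterReflection G x (Pi.single x 1) t

open Classical in
/-- The Fibonacci vector `r_t(x,y)`, starting with `r_0(x,y) = s(x) + s(y)`. -/
noncomputable def rVec (t : ℕ) (x y : V) : V → ℤ :=
  iterReflection G x (Pi.single x 1 + Pi.single y 1) t

end Vectors

section Orientations

variable {V : Type v}

/-- A vertex is a sink if no arrow starts there. -/
def IsSink (Ω : Digraph V) (x : V) : Prop := ∀ z, ¬ Ω.Adj x z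

/-- A vertex is a source if no arrow ends there. -/
def IsSource (Ω : Digraph V) (x : V) : Prop := ∀ z, ¬ Ω.Adj z x

/-- `Ω` is a bipartite orientation of the graph `G`: every edge is given exactly one
direction, and every vertex is a sink or a source. -/
structure IsBipartiteOrientation (G : SimpleGraph V) (Ω : Digraph V) : Prop where
  adj_iff : ∀ a b, G.Adj a b ↔ Ω.Adj a b ∨ Ω.Adj b a
  asymm : ∀ a b, Ω.Adj a b → ¬ Ω.Adj b a
  sink_or_source : ∀ a, IsSink Ω a ∨ IsSource Ω a

/-- `Ω` is the bipartite orientation `Ω^x_t` of `G`: the one for which `x` is a sink if `t`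
is even and a source if `t` is odd. -/
structure IsOrientationAt (G : SimpleGraph V) (Ω : Digraph V) (t : ℕ) (x : V) : Prop where
  bipartite : IsBipartiteOrientation G Ω
  sink : Even t → IsSink Ω x
  source : Odd t → IsSource Ω x

end Orientations

section Representations

/-- A representation over the field `k` of the quiver whose arrows are the arrows of the
digraph `Ω`: a vector space at each vertex and a linear map for each arrow. -/
structure DigraphRep (k : Type u) [Field k] {V : Type v} (Ω : Digraph V) where
  space : V → Type u
  [addCommGroup : ∀ z, AddCommGroup (space z)]
  [module : ∀ z, Module k (space z)]
  map : ∀ {a b : V}, Ω.Adj a b → space a →ₗ[k] space b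

attribute [instance] DigraphRep.addCommGroup DigraphRep.module

variable {k : Type u} [Field k] {V : Type v} {Ω : Digraph V}

namespace DigraphRep

/-- A morphism of representations. -/
structure Hom (M N : DigraphRep k Ω) where
  app : ∀ z, M.space z →ₗ[k] N.space z
  comm : ∀ {a b : V} (h : Ω.Adj a b) (m : M.space a),
    app b (M.map h m) = N.map h (app a m)

/-- An isomorphism of representations. -/
structure Iso (M N : DigraphRep k Ω) where
  app : ∀ z, M.space z ≃ₗ[k] N.space z
  comm : ∀ {a b : V} (h : Ω.Adj a b) (m : M.space a),
    app b (M.map h m) = N.map h (app a m)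

/-- A subrepresentation. -/
structure Sub (M : DigraphRep k Ω) where
  space : ∀ z, Submodule k (M.space z)
  map_mem : ∀ {a b : V} (h : Ω.Adj a b) (m : M.space a), m ∈ space a → M.map h m ∈ space b

/-- `M` is indecomposable: it is nonzero, and if it is the direct sum of two
subrepresentations, then one of them is zero. -/
def IsIndecomposable (M : DigraphRep k Ω) : Prop :=
  (∃ z, Nontrivial (M.space z)) ∧
  ∀ U W : M.Sub, (∀ z, IsCompl (U.space z) (W.space z)) →
    (∀ z, U.space z = ⊥) ∨ (∀ z, W.space z = ⊥)

/-- `M` has finite-dimensional spaces, and its dimension vector is `d`. -/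
def HasDimVector (M : DigraphRep k Ω) (d : V → ℤ) : Prop :=
  ∀ z, FiniteDimensional k (M.space z) ∧ (Module.finrank k (M.space z) : ℤ) = d z

/-- The sum of the dimensions of the spaces at the sinks. -/
noncomputable def sinkDim (M : DigraphRep k Ω) : ℕ :=
  ∑ᶠ z ∈ {z | IsSink Ω z}, Module.finrank k (M.space z)

/-- `0 → A → B → C → 0` is exact (kernels and images of representations are formed
vertex by vertex). -/
def IsShortExact {A B C : DigraphRep k Ω} (f : Hom A B) (g : Hom B C) : Prop :=
  ∀ z, Function.Injective (f.app z) ∧ Function.Exact (f.app z) (g.app z) ∧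
    Function.Surjective (g.app z)

/-- The sequences `A → B → C` and `A' → B' → C'` are isomorphic: there are isomorphisms of
the three terms that commute with the maps. -/
def SeqIso {A B C A' B' C' : DigraphRep k Ω} (f : Hom A B) (g : Hom B C)
    (f' : Hom A' B') (g' : Hom B' C') : Prop :=
  ∃ (α : Iso A A') (β : Iso B B') (γ : Iso C C'),
    (∀ z m, β.app z (f.app z m) = f'.app z (α.app z m)) ∧
    (∀ z m, γ.app z (g.app z m) = g'.app z (β.app z m))

/-- `p`, `q`, `r` describe representations up to isomorphism. Such representations exist;
whichever are chosen, there is an exact sequence `0 → A → B → C → 0` with `A`, `B`, `C`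
described by `p`, `q`, `r`; and any two such exact sequences are isomorphic. -/
def ExistsUniqueShortExact (p q r : DigraphRep k Ω → Prop) : Prop :=
  (∃ A, p A) ∧ (∃ B, q B) ∧ (∃ C, r C) ∧
  (∀ A B C : DigraphRep k Ω, p A → q B → r C →
    ∃ (f : Hom A B) (g : Hom B C), IsShortExact f g) ∧
  (∀ A B C A' B' C' : DigraphRep k Ω, p A → q B → r C → p A' → q B' → r C' →
    ∀ (f : Hom A B) (g : Hom B C) (f' : Hom A' B') (g' : Hom B' C'),
      IsShortExact f g → IsShortExact f' g' → SeqIso f g f' g')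

end DigraphRep

/-- `M` is (a copy of) `P_t(x)`: the indecomposable representation of `(G, Ω^x_t)` with
dimension vector `s_t(x)`. -/
structure IsP (G : SimpleGraph V) [G.LocallyFinite] (t : ℕ) (x : V)
    (M : DigraphRep k Ω) : Prop where
  orientation : IsOrientationAt G Ω t x
  indecomposable : M.IsIndecomposable
  dimVector : M.HasDimVector (sVec G t x)

/-- `M` is (a copy of) `R_t(x,y)`, for an edge between `x` and `y`: the indecomposable
representation of `(G, Ω^x_t)` with dimension vector `r_t(x,y)`. -/
structure IsR (G : SimpleGraph V) [G.LocallyFinite] (t : ℕ) (x y : V)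
    (M : DigraphRep k Ω) : Prop where
  adj : G.Adj x y
  orientation : IsOrientationAt G Ω t x
  indecomposable : M.IsIndecomposable
  dimVector : M.HasDimVector (rVec G t x y)

end Representations

end FibonacciModules

/-!
The representations `P_t(x)` and `R_t(x,y)` are obtained from `P_0(x)` (simple) and `R_0(x,y)` (the
indecomposable representation of an arrow) by applying `t` times the Bernstein-Gelfand-Ponomarev
reflection functor at all sources, which reverses the orientation. So everything is
proved for the initial stage and carried along by reflection.

Reflection is treated as a relation instead of a functor: a `Reflection G M N` identifies the
spaces of `M` and `N` at the sinks `w` of the quiver of `M`, and has a short exact sequence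
`0 → M_z → ⨁ M_w → N_z → 0` at each source `z`, the sum being over the neighbours of `z`.
Such an `N` exists if the maps `M_z → ⨁ M_w` are injective (`Reflection.exists_up`), such an `M`
exists if the maps `⨁ N_w → N_z` are surjective (`Reflection.exists_down`), and morphisms,
isomorphisms, dimension vectors and decompositions correspond to each other. For indecomposable
representations injectivity or surjectivity can fail only for one concentrated at a
single vertex. This is excluded by counting: in a 3-regular graph, the sums `S` over the sinks
and `Q` over the sources turn into `3 S - Q` and `S` (`sinkSum_reflect`). For `P_t` and `R_t` this
makes `S` equal to the Fibonacci numbers `f_{2t+2}` and `f_{2t+1}`, which are positive, and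
gives the numerical assertions as well.

* Uniqueness of `P_t` and `R_t` is reduced to `t = 0` by reflecting at the sinks
  (`IsReflected.nonempty_iso`).
* The exact sequences are evident for `t = 1`, where all terms are thin representations on parts of
  the star around `x` (`exists_thin_isShortExact`). Reflection at the sources is right exact, and by
  the snake lemma it preserves a short exact sequence if the maps of the third term at the sources
  are injective (`Reflection.isShortExact_up`).
* In both sequences the morphisms from the first to the second term form a space of dimension
  at most one: this is clear for `t = 1`, and reflection at the sinks is faithful (`HomLine.up`).
  Hence two such embeddings differ by a scalar, so the sequences are isomorphic (`seqIso_of_homLine`).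
-/

namespace FibonacciModules

/-! ### Bipartite orientations -/

section Orientations

variable {V : Type v} {G : SimpleGraph V} {Ω Ω' : Digraph V}

/-- `Ω'` is obtained from `Ω` by reversing all arrows. -/
def Opposite (Ω Ω' : Digraph V) : Prop := ∀ a b, Ω'.Adj a b ↔ Ω.Adj b a

theorem exists_opposite (Ω : Digraph V) : ∃ Ω' : Digraph V, Opposite Ω Ω' :=
  ⟨⟨fun a b => Ω.Adj b a⟩, fun _ _ => Iff.rfl⟩

theorem Opposite.symm (h : Opposite Ω Ω') : Opposite Ω' Ω := fun a b => (h b a).symm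

theorem Opposite.isSink_iff (h : Opposite Ω Ω') (z : V) : IsSink Ω' z ↔ IsSource Ω z :=
  forall_congr' fun w => not_congr (h z w)

theorem Opposite.isSource_iff (h : Opposite Ω Ω') (z : V) : IsSource Ω' z ↔ IsSink Ω z :=
  forall_congr' fun w => not_congr (h w z)

namespace IsBipartiteOrientation

theorem opposite (hΩ : IsBipartiteOrientation G Ω) (h : Opposite Ω Ω') :
    IsBipartiteOrientation G Ω' where
  adj_iff a b := by rw [h, h, hΩ.adj_iff, or_comm]
  asymm a b := by rw [h, h]; exact hΩ.asymm b a
  sink_or_source a := by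
    rw [h.isSink_iff, h.isSource_iff]; exact (hΩ.sink_or_source a).symm

theorem adj (hΩ : IsBipartiteOrientation G Ω) {a b : V} (h : Ω.Adj a b) : G.Adj a b :=
  (hΩ.adj_iff a b).2 (Or.inl h)

theorem adj_of_isSource (hΩ : IsBipartiteOrientation G Ω) {a b : V} (ha : IsSource Ω a)
    (h : G.Adj a b) : Ω.Adj a b :=
  ((hΩ.adj_iff a b).1 h).resolve_right (ha b)

theorem adj_of_isSink (hΩ : IsBipartiteOrientation G Ω) {a b : V} (hb : IsSink Ω b)
    (h : G.Adj a b) : Ω.Adj a b :=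
  ((hΩ.adj_iff a b).1 h).resolve_right (hb a)

theorem isSource_left (hΩ : IsBipartiteOrientation G Ω) {a b : V} (h : Ω.Adj a b) :
    IsSource Ω a :=
  (hΩ.sink_or_source a).resolve_left fun ha => ha b h

theorem isSink_right (hΩ : IsBipartiteOrientation G Ω) {a b : V} (h : Ω.Adj a b) :
    IsSink Ω b :=
  (hΩ.sink_or_source b).resolve_right fun hb => hb a h

theorem isSink_of_adj (hΩ : IsBipartiteOrientation G Ω) {a b : V} (ha : IsSource Ω a)
    (h : G.Adj a b) : IsSink Ω b :=
  hΩ.isSink_right (hΩ.adj_of_isSource ha h)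

theorem isSource_of_adj (hΩ : IsBipartiteOrientation G Ω) {a b : V} (ha : IsSink Ω a)
    (h : G.Adj a b) : IsSource Ω b :=
  hΩ.isSource_left (hΩ.adj_of_isSink ha h.symm)

theorem not_isSource (hΩ : IsBipartiteOrientation G Ω) (hN : ∀ z, ∃ w, G.Adj z w) {a : V}
    (ha : IsSink Ω a) : ¬ IsSource Ω a := fun h =>
  let ⟨b, hb⟩ := hN a
  ha b (hΩ.adj_of_isSource h hb)

theorem not_isSink (hΩ : IsBipartiteOrientation G Ω) (hN : ∀ z, ∃ w, G.Adj z w) {a : V}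
    (ha : IsSource Ω a) : ¬ IsSink Ω a := fun h => hΩ.not_isSource hN h ha

end IsBipartiteOrientation

end Orientations

/-! ### Reflected representations -/

section Reflections

variable {k : Type u} [Field k] {V : Type v} {Ω Ω' : Digraph V}

namespace DigraphRep

open Classical in
/-- The map `M_a → M_b` of a representation, extended by zero to all pairs of vertices. -/
noncomputable def tmap (M : DigraphRep k Ω) (a b : V) : M.space a →ₗ[k] M.space b :=
  if h : Ω.Adj a b then M.map h else 0

theorem tmap_of_adj (M : DigraphRep k Ω) {a b : V} (h : Ω.Adj a b) : M.tmap a b = M.map h :=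
  dif_pos h

theorem tmap_of_not_adj (M : DigraphRep k Ω) {a b : V} (h : ¬ Ω.Adj a b) : M.tmap a b = 0 :=
  dif_neg h

theorem Hom.comm_tmap {M N : DigraphRep k Ω} (f : Hom M N) (a b : V) (m : M.space a) :
    f.app b (M.tmap a b m) = N.tmap a b (f.app a m) := by
  by_cases h : Ω.Adj a b
  · rw [tmap_of_adj _ h, tmap_of_adj _ h, f.comm]
  · simp [tmap_of_not_adj _ h]

theorem Sub.tmap_mem {M : DigraphRep k Ω} (U : M.Sub) (a b : V) {m : M.space a}
    (hm : m ∈ U.space a) : M.tmap a b m ∈ U.space b := by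
  by_cases h : Ω.Adj a b
  · rw [tmap_of_adj _ h]; exact U.map_mem h m hm
  · simp [tmap_of_not_adj _ h]

/-- The identity morphism. -/
def Hom.id (M : DigraphRep k Ω) : Hom M M := ⟨fun _ => LinearMap.id, fun _ _ => rfl⟩

/-- Composition of morphisms, in the order of application. -/
def Hom.comp {A B C : DigraphRep k Ω} (f : Hom A B) (g : Hom B C) : Hom A C :=
  ⟨fun z => g.app z ∘ₗ f.app z, fun h m => by simp [f.comm, g.comm]⟩

/-- The morphism underlying an isomorphism. -/
def Iso.hom {M N : DigraphRep k Ω} (α : Iso M N) : Hom M N :=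
  ⟨fun z => (α.app z).toLinearMap, fun h m => α.comm h m⟩

/-- The inverse isomorphism. -/
def Iso.symm {M N : DigraphRep k Ω} (α : Iso M N) : Iso N M :=
  ⟨fun z => (α.app z).symm, fun {a b} h m => by
    rw [LinearEquiv.symm_apply_eq, α.comm, LinearEquiv.apply_symm_apply]⟩

variable (G : SimpleGraph V)

/-- The map `M_z → ⨁ M_w`, the sum over the neighbours `w` of `z`, given by the arrows
starting at `z`. -/
noncomputable def outMap (M : DigraphRep k Ω) (z : V) :
    M.space z →ₗ[k] (∀ w : G.neighborSet z, M.space w) :=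
  LinearMap.pi fun w => M.tmap z w

@[simp] theorem outMap_apply (M : DigraphRep k Ω) (z : V) (m : M.space z)
    (w : G.neighborSet z) : M.outMap G z m w = M.tmap z w m := rfl

variable [G.LocallyFinite]

/-- The map `⨁ N_w → N_z`, the sum over the neighbours `w` of `z`, given by the arrows
ending at `z`. -/
noncomputable def sumMap (N : DigraphRep k Ω) (z : V) :
    (∀ w : G.neighborSet z, N.space w) →ₗ[k] N.space z :=
  ∑ w : G.neighborSet z, N.tmap w z ∘ₗ LinearMap.proj w

theorem sumMap_apply (N : DigraphRep k Ω) (z : V) (n : ∀ w : G.neighborSet z, N.space w) :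
    N.sumMap G z n = ∑ w : G.neighborSet z, N.tmap w z (n w) := by
  simp [sumMap]

open Classical in
theorem sumMap_single (N : DigraphRep k Ω) (z : V) (w : G.neighborSet z) (n : N.space w) :
    N.sumMap G z (Pi.single w n) = N.tmap w z n := by
  rw [sumMap_apply, Finset.sum_eq_single w]
  · simp
  · intro b _ hb
    simp [Pi.single_eq_of_ne hb]
  · simp

end DigraphRep

open DigraphRep

variable (G : SimpleGraph V) [G.LocallyFinite]

/-- The map `⨁ M_w → N_z` obtained by identifying `M_w` with `N_w` by means of `e` and
following the arrows of `N` ending at `z`. -/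
noncomputable def gather {M : DigraphRep k Ω} {N : DigraphRep k Ω'}
    (e : ∀ z, M.space z →ₗ[k] N.space z) (z : V) :
    (∀ w : G.neighborSet z, M.space w) →ₗ[k] N.space z :=
  N.sumMap G z ∘ₗ LinearMap.piMap fun w : G.neighborSet z => e w

/-- A reflection datum between a representation `M` of `Ω` and a representation `N` of the
opposite quiver `Ω'`: the spaces of `M` and `N` at the sinks of `Ω` are identified, and
at each source `z` of `Ω` there is a short exact sequence `0 → M_z → ⨁ M_w → N_z → 0`. It says
that `N` arises from `M` by the reflection functors at all sources of `Ω`, and equally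
that `M` arises from `N` by the reflection functors at all sinks of `Ω'`. At the sources of `Ω`
the maps `e` carry no information. -/
structure Reflection (M : DigraphRep k Ω) (N : DigraphRep k Ω') where
  e : ∀ z, M.space z →ₗ[k] N.space z
  bij : ∀ z, IsSink Ω z → Function.Bijective (e z)
  inj : ∀ z, IsSource Ω z → Function.Injective (M.outMap G z)
  exact : ∀ z, IsSource Ω z → Function.Exact (M.outMap G z) (gather G e z)
  surj : ∀ z, IsSource Ω z → Function.Surjective (gather G e z)

variable {G}

theorem gather_apply {M : DigraphRep k Ω} {N : DigraphRep k Ω'}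
    (e : ∀ z, M.space z →ₗ[k] N.space z) (z : V) (m : ∀ w : G.neighborSet z, M.space w) :
    gather G e z m = ∑ w : G.neighborSet z, N.tmap w z (e w (m w)) := by
  simp [gather, sumMap_apply]

open Classical in
theorem gather_single {M : DigraphRep k Ω} {N : DigraphRep k Ω'}
    (e : ∀ z, M.space z →ₗ[k] N.space z) (z : V) (w : G.neighborSet z) (m : M.space w) :
    gather G e z (Pi.single w m) = N.tmap w z (e w m) := by
  rw [gather_apply, Finset.sum_eq_single w]
  · simp
  · intro b _ hb
    simp [Pi.single_eq_of_ne hb]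
  · simp

theorem gather_mem {M : DigraphRep k Ω} {N : DigraphRep k Ω'}
    (e : ∀ z, M.space z →ₗ[k] N.space z) (U : N.Sub) (z : V)
    {m : ∀ w : G.neighborSet z, M.space w}
    (hm : ∀ w : G.neighborSet z, e w (m w) ∈ U.space w) :
    gather G e z m ∈ U.space z := by
  rw [gather_apply]
  exact Submodule.sum_mem _ fun w _ => U.tmap_mem _ _ (hm w)

variable {M M' : DigraphRep k Ω} {N N' : DigraphRep k Ω'}

namespace Reflection

/-- Two morphisms out of a reflected representation are proportional if they are so at the
sinks of the original orientation, because the arrows ending at the other vertices are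
jointly surjective. -/
theorem smul_ext (hΩ : IsBipartiteOrientation G Ω) (R : Reflection G M N) (g g' : Hom N N')
    (c : k) (h : ∀ w, IsSink Ω w → ∀ n, g'.app w n = c • g.app w n) (z : V) (n : N.space z) :
    g'.app z n = c • g.app z n := by
  rcases hΩ.sink_or_source z with hz | hz
  · exact h z hz n
  · obtain ⟨m, rfl⟩ := R.surj z hz n
    rw [gather_apply, map_sum, map_sum, Finset.smul_sum]
    refine Finset.sum_congr rfl fun w _ => ?_
    rw [g.comm_tmap, g'.comm_tmap, h _ (hΩ.isSink_of_adj hz w.2), map_smul]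

/-- The reflection at the sources, on morphisms. -/
theorem exists_hom_up (hΩ : IsBipartiteOrientation G Ω) (hop : Opposite Ω Ω')
    (hN : ∀ z, ∃ w, G.Adj z w)
    (R : Reflection G M N) (R' : Reflection G M' N') (f : Hom M M') :
    ∃ g : Hom N N',
      (∀ w, IsSink Ω w → ∀ m, g.app w (R.e w m) = R'.e w (f.app w m)) ∧
      ∀ z, IsSource Ω z → ∀ m : ∀ w : G.neighborSet z, M.space w,
        g.app z (gather G R.e z m) = gather G R'.e z fun w => f.app w (m w) := by
  classical
  have key : ∀ z, ∃ g : N.space z →ₗ[k] N'.space z,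
      (IsSink Ω z → ∀ m, g (R.e z m) = R'.e z (f.app z m)) ∧
      (IsSource Ω z → ∀ m : ∀ w : G.neighborSet z, M.space w,
        g (gather G R.e z m) = gather G R'.e z fun w => f.app w (m w)) := by
    intro z
    rcases hΩ.sink_or_source z with hz | hz
    · refine ⟨R'.e z ∘ₗ f.app z ∘ₗ (LinearEquiv.ofBijective (R.e z) (R.bij z hz)).symm,
        fun _ m => ?_, fun h => absurd h (hΩ.not_isSource hN hz)⟩
      have := (LinearEquiv.ofBijective (R.e z) (R.bij z hz)).symm_apply_apply m
      simp only [LinearEquiv.ofBijective_apply] at this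
      simp [this]
    · obtain ⟨r, hr⟩ := (gather G R.e z).exists_rightInverse_of_surjective
        (LinearMap.range_eq_top.2 (R.surj z hz))
      refine ⟨gather G R'.e z ∘ₗ (LinearMap.piMap fun w : G.neighborSet z => f.app w) ∘ₗ r,
        fun h => absurd hz (hΩ.not_isSource hN h), fun _ m => ?_⟩
      have h0 : gather G R.e z (r (gather G R.e z m) - m) = 0 := by
        rw [map_sub, sub_eq_zero]
        exact LinearMap.congr_fun hr _
      obtain ⟨m0, hm0⟩ := (R.exact z hz _).1 h0
      have h1 : (gather G R'.e z)
          ((LinearMap.piMap fun w : G.neighborSet z => f.app w) (M.outMap G z m0)) = 0 := by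
        refine (R'.exact z hz _).2 ⟨f.app z m0, ?_⟩
        funext w
        simp [f.comm_tmap]
      rw [hm0, map_sub, map_sub, sub_eq_zero] at h1
      exact h1
  choose g hg1 hg2 using key
  refine ⟨⟨g, fun {a b} h n => ?_⟩, hg1, hg2⟩
  have hab : Ω.Adj b a := (hop a b).1 h
  have ha : IsSink Ω a := hΩ.isSink_right hab
  have hb : IsSource Ω b := hΩ.isSource_left hab
  obtain ⟨m, rfl⟩ := (R.bij a ha).2 n
  let w : G.neighborSet b := ⟨a, hΩ.adj hab⟩
  rw [← N.tmap_of_adj h, ← N'.tmap_of_adj h, hg1 a ha]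
  have h1 : gather G R.e b (Pi.single w m) = N.tmap a b (R.e a m) := gather_single R.e b w m
  have h2 : gather G R'.e b (Pi.single w (f.app a m)) = N'.tmap a b (R'.e a (f.app a m)) :=
    gather_single R'.e b w _
  rw [← h1, ← h2, hg2 b hb]
  congr 1
  funext w'
  by_cases hw : w' = w
  · subst hw; simp [w]
  · simp [Pi.single_eq_of_ne hw]

/-- The reflection at the sinks, on morphisms. -/
theorem exists_hom_down (hΩ : IsBipartiteOrientation G Ω) (hN : ∀ z, ∃ w, G.Adj z w)
    (R : Reflection G M N) (R' : Reflection G M' N') (g : Hom N N') :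
    ∃ f : Hom M M', ∀ w, IsSink Ω w → ∀ m, g.app w (R.e w m) = R'.e w (f.app w m) := by
  have key : ∀ z, ∃ φ : M.space z →ₗ[k] M'.space z,
      IsSink Ω z → ∀ m, g.app z (R.e z m) = R'.e z (φ m) := by
    intro z
    by_cases hz : IsSink Ω z
    · refine ⟨(LinearEquiv.ofBijective (R'.e z) (R'.bij z hz)).symm.toLinearMap ∘ₗ
        g.app z ∘ₗ R.e z, fun _ m => ?_⟩
      exact ((LinearEquiv.ofBijective (R'.e z) (R'.bij z hz)).apply_symm_apply _).symm
    · exact ⟨0, fun h => absurd h hz⟩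
  choose φ hφ using key
  have key2 : ∀ z, ∃ ψ : M.space z →ₗ[k] M'.space z, (IsSink Ω z → ψ = φ z) ∧
      (IsSource Ω z → ∀ m (w : G.neighborSet z), φ w (M.tmap z w m) = M'.tmap z w (ψ m)) := by
    intro z
    rcases hΩ.sink_or_source z with hz | hz
    · exact ⟨φ z, fun _ => rfl, fun h => absurd h (hΩ.not_isSource hN hz)⟩
    · obtain ⟨l, hl⟩ := (M'.outMap G z).exists_leftInverse_of_injective
        (LinearMap.ker_eq_bot.2 (R'.inj z hz))
      refine ⟨l ∘ₗ (LinearMap.piMap fun w : G.neighborSet z => φ w) ∘ₗ M.outMap G z,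
        fun h => absurd hz (hΩ.not_isSource hN h), fun _ m w => ?_⟩
      have h0 : gather G R'.e z
          ((LinearMap.piMap fun w : G.neighborSet z => φ w) (M.outMap G z m)) = 0 := by
        have h1 : gather G R.e z (M.outMap G z m) = 0 := (R.exact z hz _).2 ⟨m, rfl⟩
        have h2 := congrArg (g.app z) h1
        rw [map_zero, gather_apply, map_sum] at h2
        rw [gather_apply, ← h2]
        refine Finset.sum_congr rfl fun w _ => ?_
        rw [g.comm_tmap, hφ _ (hΩ.isSink_of_adj hz w.2)]
        rfl
      obtain ⟨m', hm'⟩ := (R'.exact z hz _).1 h0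
      have h3 : l ((LinearMap.piMap fun w : G.neighborSet z => φ w) (M.outMap G z m)) = m' := by
        rw [← hm']; exact LinearMap.congr_fun hl m'
      simp only [LinearMap.comp_apply, h3]
      exact (congrFun hm' w).symm
  choose ψ hψ1 hψ2 using key2
  refine ⟨⟨ψ, fun {a b} h m => ?_⟩, fun w hw m => by rw [hφ w hw, ← hψ1 w hw]⟩
  rw [hψ1 b (hΩ.isSink_right h), ← M.tmap_of_adj h, ← M'.tmap_of_adj h]
  exact hψ2 a (hΩ.isSource_left h) m ⟨b, hΩ.adj h⟩

theorem iso_up (hΩ : IsBipartiteOrientation G Ω) (hop : Opposite Ω Ω')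
    (hN : ∀ z, ∃ w, G.Adj z w)
    (R : Reflection G M N) (R' : Reflection G M' N') (α : Iso M M') : Nonempty (Iso N N') := by
  obtain ⟨g, hg, -⟩ := exists_hom_up hΩ hop hN R R' α.hom
  obtain ⟨g', hg', -⟩ := exists_hom_up hΩ hop hN R' R α.symm.hom
  have h1 : ∀ z n, g'.app z (g.app z n) = n := fun z n => by
    have := smul_ext hΩ R (Hom.id N) (g.comp g') 1 (fun w hw n => by
      obtain ⟨m, rfl⟩ := (R.bij w hw).2 n
      simp [Hom.comp, Hom.id, hg w hw, hg' w hw, Iso.hom, Iso.symm]) z n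
    simpa [Hom.comp, Hom.id] using this
  have h2 : ∀ z n, g.app z (g'.app z n) = n := fun z n => by
    have := smul_ext hΩ R' (Hom.id N') (g'.comp g) 1 (fun w hw n => by
      obtain ⟨m, rfl⟩ := (R'.bij w hw).2 n
      simp [Hom.comp, Hom.id, hg w hw, hg' w hw, Iso.hom, Iso.symm]) z n
    simpa [Hom.comp, Hom.id] using this
  exact ⟨⟨fun z => LinearEquiv.ofLinearMap (g.app z) (g'.app z)
    (LinearMap.ext (h2 z)) (LinearMap.ext (h1 z)), fun h m => g.comm h m⟩⟩

/-- The reflection functor at the sources preserves exactness of a short exact sequence of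
representations whose maps at the sources are injective (snake lemma). -/
theorem isShortExact_up (hΩ : IsBipartiteOrientation G Ω) (hop : Opposite Ω Ω')
    (hN : ∀ z, ∃ w, G.Adj z w)
    {A B C : DigraphRep k Ω} {A' B' C' : DigraphRep k Ω'}
    (RA : Reflection G A A') (RB : Reflection G B B') (RC : Reflection G C C')
    (f : Hom A B) (g : Hom B C) (hfg : IsShortExact f g) :
    ∃ (f' : Hom A' B') (g' : Hom B' C'), IsShortExact f' g' := by
  obtain ⟨f', hf1, hf2⟩ := exists_hom_up hΩ hop hN RA RB f
  obtain ⟨g', hg1, hg2⟩ := exists_hom_up hΩ hop hN RB RC g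
  have hfi := fun z => (hfg z).1
  have hex := fun z => (hfg z).2.1
  have hgs := fun z => (hfg z).2.2
  refine ⟨f', g', fun z => ?_⟩
  rcases hΩ.sink_or_source z with hz | hz
  · have bA := RA.bij z hz
    have bB := RB.bij z hz
    have bC := RC.bij z hz
    refine ⟨?_, ?_, ?_⟩
    · rw [injective_iff_map_eq_zero]
      intro n hn
      obtain ⟨a, rfl⟩ := bA.2 n
      rw [hf1 z hz, map_eq_zero_iff _ bB.1, map_eq_zero_iff _ (hfi z)] at hn
      rw [hn, map_zero]
    · intro n
      obtain ⟨b, rfl⟩ := bB.2 n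
      rw [hg1 z hz, map_eq_zero_iff _ bC.1, hex z b]
      constructor
      · rintro ⟨a, rfl⟩
        exact ⟨_, hf1 z hz a⟩
      · rintro ⟨n, hn⟩
        obtain ⟨a, rfl⟩ := bA.2 n
        rw [hf1 z hz] at hn
        exact ⟨a, bB.1 hn⟩
    · intro n
      obtain ⟨c, rfl⟩ := bC.2 n
      obtain ⟨b, rfl⟩ := hgs z c
      exact ⟨_, hg1 z hz b⟩
  · refine ⟨?_, ?_, ?_⟩
    · rw [injective_iff_map_eq_zero]
      intro n hn
      obtain ⟨a, rfl⟩ := RA.surj z hz n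
      rw [hf2 z hz] at hn
      obtain ⟨b, hb⟩ := (RB.exact z hz _).1 hn
      have hb' : ∀ w : G.neighborSet z, B.tmap z w b = f.app w (a w) := fun w => congrFun hb w
      have hgb : g.app z b = 0 := by
        apply RC.inj z hz
        rw [map_zero]
        funext w
        rw [outMap_apply, ← g.comm_tmap, hb' w]
        exact (hex w _).2 ⟨_, rfl⟩
      obtain ⟨a0, rfl⟩ := (hex z b).1 hgb
      refine (RA.exact z hz _).2 ⟨a0, ?_⟩
      funext w
      apply hfi w
      rw [outMap_apply, f.comm_tmap, hb' w]
    · intro n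
      constructor
      · intro hn
        obtain ⟨b, rfl⟩ := RB.surj z hz n
        rw [hg2 z hz] at hn
        obtain ⟨c, hc⟩ := (RC.exact z hz _).1 hn
        obtain ⟨b0, rfl⟩ := hgs z c
        have hc' : ∀ w : G.neighborSet z, C.tmap z w (g.app z b0) = g.app w (b w) :=
          fun w => congrFun hc w
        have : ∀ w : G.neighborSet z, ∃ a : A.space w, f.app w a = b w - B.tmap z w b0 := by
          intro w
          refine (hex w _).1 ?_
          rw [map_sub, g.comm_tmap, hc' w, sub_self]
        choose a ha using this
        refine ⟨gather G RA.e z a, ?_⟩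
        rw [hf2 z hz]
        have h1 : (fun w : G.neighborSet z => f.app w (a w)) = b - B.outMap G z b0 := by
          funext w; rw [ha w]; rfl
        rw [h1, map_sub, (RB.exact z hz _).2 ⟨b0, rfl⟩, sub_zero]
      · rintro ⟨n, rfl⟩
        obtain ⟨a, rfl⟩ := RA.surj z hz n
        rw [hf2 z hz, hg2 z hz]
        have : (fun w : G.neighborSet z => g.app w (f.app w (a w))) = 0 := by
          funext w; exact (hex w _).2 ⟨_, rfl⟩
        rw [this, map_zero]
    · intro n
      obtain ⟨c, rfl⟩ := RC.surj z hz n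
      choose b hb using fun w : G.neighborSet z => hgs w (c w)
      refine ⟨gather G RB.e z b, ?_⟩
      rw [hg2 z hz]
      exact congrArg _ (funext hb)

end Reflection

end Reflections

/-! ### Existence of reflections and their dimension vectors -/

section Existence

variable {k : Type u} [Field k] {V : Type v} {Ω Ω' : Digraph V}
variable {G : SimpleGraph V} [G.LocallyFinite]

open DigraphRep

namespace Reflection

/-- The reflection functor at the sources, on objects. The new spaces are modelled on `Fin n → k`,
so that they live in the universe of `k`, whatever the universe of the vertices is. -/
theorem exists_up (hΩ : IsBipartiteOrientation G Ω) (hop : Opposite Ω Ω')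
    (hN : ∀ z, ∃ w, G.Adj z w) (M : DigraphRep k Ω)
    (hfd : ∀ z, FiniteDimensional k (M.space z))
    (hinj : ∀ z, IsSource Ω z → Function.Injective (M.outMap G z)) :
    ∃ N : DigraphRep k Ω', Nonempty (Reflection G M N) := by
  classical
  have key : ∀ z, ∃ (n : ℕ) (e : M.space z →ₗ[k] (Fin n → k)) (i : (Fin n → k) →ₗ[k] M.space z)
      (q : (∀ w : G.neighborSet z, M.space w) →ₗ[k] (Fin n → k)),
      (IsSink Ω z → (∀ m, i (e m) = m) ∧ ∀ n, e (i n) = n) ∧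
      (IsSource Ω z → Function.Exact (M.outMap G z) q ∧ Function.Surjective q) := by
    intro z
    rcases hΩ.sink_or_source z with hz | hz
    · let b := (Module.finBasis k (M.space z)).equivFun
      exact ⟨_, b.toLinearMap, b.symm.toLinearMap, 0,
        fun _ => ⟨b.symm_apply_apply, b.apply_symm_apply⟩,
        fun h => absurd h (hΩ.not_isSource hN hz)⟩
    · let b := (Module.finBasis k
        ((∀ w : G.neighborSet z, M.space w) ⧸ LinearMap.range (M.outMap G z))).equivFun
      refine ⟨_, 0, 0, b.toLinearMap ∘ₗ (LinearMap.range (M.outMap G z)).mkQ,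
        fun h => absurd hz (hΩ.not_isSource hN h), fun _ => ⟨fun m => ?_, ?_⟩⟩
      · simp [Submodule.Quotient.mk_eq_zero]
      · exact b.surjective.comp (Submodule.mkQ_surjective _)
  choose n e i q he hq using key
  let N : DigraphRep k Ω' :=
    { space := fun z => Fin (n z) → k
      map := fun {a b} h => q b ∘ₗ
        LinearMap.single k (fun w : G.neighborSet b => M.space w)
          ⟨a, hΩ.adj ((hop a b).1 h)⟩ ∘ₗ i a }
  have hgq : ∀ z, IsSource Ω z → ∀ m, gather (N := N) G e z m = q z m := by
    intro z hz m
    rw [gather_apply]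
    have : ∀ w : G.neighborSet z, N.tmap w z (e w (m w)) = q z (Pi.single w (m w)) := by
      intro w
      rw [N.tmap_of_adj ((hop w z).2 (hΩ.adj_of_isSource hz w.2))]
      change q z (Pi.single _ (i w (e w (m w)))) = _
      rw [(he w (hΩ.isSink_of_adj hz w.2)).1]
    rw [Finset.sum_congr rfl fun w _ => this w, ← map_sum, Finset.univ_sum_single]
  refine ⟨N, ⟨⟨e, fun z hz => ?_, hinj, fun z hz => ?_, fun z hz => ?_⟩⟩⟩
  · exact ⟨Function.LeftInverse.injective (he z hz).1,
      Function.RightInverse.surjective (he z hz).2⟩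
  · intro m
    rw [hgq z hz]
    exact (hq z hz).1 m
  · intro x
    obtain ⟨m, hm⟩ := (hq z hz).2 x
    exact ⟨m, (hgq z hz m).trans hm⟩

/-- The reflection functor at the sinks, on objects. -/
theorem exists_down (hΩ : IsBipartiteOrientation G Ω)
    (hN : ∀ z, ∃ w, G.Adj z w) (N : DigraphRep k Ω')
    (hfd : ∀ z, FiniteDimensional k (N.space z))
    (hsurj : ∀ z, IsSource Ω z → Function.Surjective (N.sumMap G z)) :
    ∃ M : DigraphRep k Ω, Nonempty (Reflection G M N) := by
  classical
  have key : ∀ z, ∃ (n : ℕ) (e : (Fin n → k) →ₗ[k] N.space z) (i : N.space z →ₗ[k] (Fin n → k))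
      (j : (Fin n → k) →ₗ[k] (∀ w : G.neighborSet z, N.space w)),
      (IsSink Ω z → (∀ m, i (e m) = m) ∧ ∀ n, e (i n) = n) ∧
      (IsSource Ω z → Function.Injective j ∧ Function.Exact j (N.sumMap G z)) := by
    intro z
    rcases hΩ.sink_or_source z with hz | hz
    · let b := (Module.finBasis k (N.space z)).equivFun
      exact ⟨_, b.symm.toLinearMap, b.toLinearMap, 0,
        fun _ => ⟨b.apply_symm_apply, b.symm_apply_apply⟩,
        fun h => absurd h (hΩ.not_isSource hN hz)⟩
    · let b := (Module.finBasis k (LinearMap.ker (N.sumMap G z))).equivFun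
      refine ⟨_, 0, 0, (LinearMap.ker (N.sumMap G z)).subtype ∘ₗ b.symm.toLinearMap,
        fun h => absurd hz (hΩ.not_isSource hN h), fun _ => ⟨?_, fun m => ⟨fun h => ?_, ?_⟩⟩⟩
      · exact Subtype.val_injective.comp b.symm.injective
      · exact ⟨b ⟨m, h⟩, by simp⟩
      · rintro ⟨x, rfl⟩
        exact (b.symm x).2
  choose n e i j he hj using key
  let M : DigraphRep k Ω :=
    { space := fun z => Fin (n z) → k
      map := fun {a b} h => i b ∘ₗ LinearMap.proj (⟨b, hΩ.adj h⟩ : G.neighborSet a) ∘ₗ j a }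
  have hout : ∀ z, IsSource Ω z → ∀ m (w : G.neighborSet z),
      e w (M.outMap G z m w) = j z m w := by
    intro z hz m w
    rw [outMap_apply, M.tmap_of_adj (hΩ.adj_of_isSource hz w.2)]
    exact (he w (hΩ.isSink_of_adj hz w.2)).2 _
  have hinj : ∀ z, IsSink Ω z → Function.Injective (e z) := fun z hz =>
    Function.LeftInverse.injective (he z hz).1
  refine ⟨M, ⟨⟨e, fun z hz => ⟨hinj z hz, ?_⟩, fun z hz => ?_, fun z hz => ?_, fun z hz => ?_⟩⟩⟩
  · exact Function.RightInverse.surjective (he z hz).2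
  · intro m m' h
    apply (hj z hz).1
    funext w
    rw [← hout z hz, ← hout z hz, h]
  · intro m
    refine ((hj z hz).2 _).trans ?_
    constructor
    · rintro ⟨x, hx⟩
      refine ⟨x, funext fun w => hinj w (hΩ.isSink_of_adj hz w.2) ?_⟩
      rw [hout z hz, hx]
      rfl
    · rintro ⟨x, hx⟩
      refine ⟨x, funext fun w => ?_⟩
      rw [← hout z hz, hx]
      rfl
  · refine (hsurj z hz).comp fun x => ⟨fun w => i w (x w), funext fun w => ?_⟩
    exact (he w (hΩ.isSink_of_adj hz w.2)).2 _

variable {M : DigraphRep k Ω} {N : DigraphRep k Ω'}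

theorem finiteDimensional (hΩ : IsBipartiteOrientation G Ω) (R : Reflection G M N) :
    (∀ z, FiniteDimensional k (M.space z)) ↔ ∀ z, FiniteDimensional k (N.space z) := by
  have hs : ∀ z, IsSink Ω z →
      (FiniteDimensional k (M.space z) ↔ FiniteDimensional k (N.space z)) := fun z hz =>
    ⟨fun _ => Module.Finite.equiv (LinearEquiv.ofBijective (R.e z) (R.bij z hz)),
      fun _ => Module.Finite.equiv (LinearEquiv.ofBijective (R.e z) (R.bij z hz)).symm⟩
  constructor
  · intro h z
    rcases hΩ.sink_or_source z with hz | hz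
    · exact (hs z hz).1 (h z)
    · exact Module.Finite.of_surjective _ (R.surj z hz)
  · intro h z
    rcases hΩ.sink_or_source z with hz | hz
    · exact (hs z hz).2 (h z)
    · have : ∀ w : G.neighborSet z, FiniteDimensional k (M.space w) := fun w =>
        (hs w (hΩ.isSink_of_adj hz w.2)).2 (h w)
      exact Module.Finite.of_injective _ (R.inj z hz)

theorem finrank_sink (R : Reflection G M N) {z : V} (hz : IsSink Ω z) :
    Module.finrank k (M.space z) = Module.finrank k (N.space z) :=
  (LinearEquiv.ofBijective (R.e z) (R.bij z hz)).finrank_eq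

theorem finrank_source (hfd : ∀ z, FiniteDimensional k (M.space z)) (R : Reflection G M N)
    {z : V} (hz : IsSource Ω z) :
    Module.finrank k (N.space z) + Module.finrank k (M.space z) =
      ∑ w ∈ G.neighborFinset z, Module.finrank k (M.space w) := by
  have h1 := (gather G R.e z).finrank_range_add_finrank_ker
  rw [LinearMap.range_eq_top.2 (R.surj z hz), finrank_top,
    (R.exact z hz).linearMap_ker_eq, LinearMap.finrank_range_of_inj (R.inj z hz),
    Module.finrank_pi_fintype] at h1
  rw [h1]
  exact Finset.sum_set_coe (G.neighborSet z)
    (f := fun w => Module.finrank k (M.space w))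

/-- Reflection of dimension vectors, the two directions at once: only the entries at the
sources of `Ω` change. -/
theorem hasDimVector_iff (hΩ : IsBipartiteOrientation G Ω)
    (R : Reflection G M N) {d d' : V → ℤ} (hsink : ∀ z, IsSink Ω z → d' z = d z)
    (hsource : ∀ z, IsSource Ω z → d' z = -d z + ∑ w ∈ G.neighborFinset z, d w) :
    M.HasDimVector d ↔ N.HasDimVector d' := by
  have hfd := R.finiteDimensional hΩ
  constructor
  · intro h z
    have hM := fun z => (h z).1
    refine ⟨hfd.1 hM z, ?_⟩
    rcases hΩ.sink_or_source z with hz | hz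
    · rw [hsink z hz, ← (h z).2, R.finrank_sink hz]
    · rw [hsource z hz, ← (h z).2, ← Finset.sum_congr rfl fun w _ => (h w).2]
      have := R.finrank_source hM hz
      push_cast [← Nat.cast_sum, ← this]
      ring
  · intro h z
    have hM := hfd.2 fun z => (h z).1
    refine ⟨hM z, ?_⟩
    rcases hΩ.sink_or_source z with hz | hz
    · rw [← hsink z hz, ← (h z).2, R.finrank_sink hz]
    · have h1 := R.finrank_source hM hz
      have h2 : (∑ w ∈ G.neighborFinset z, (Module.finrank k (M.space w) : ℤ)) =
          ∑ w ∈ G.neighborFinset z, d w := by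
        refine Finset.sum_congr rfl fun w hw => ?_
        have hw' := hΩ.isSink_of_adj hz ((G.mem_neighborFinset z w).1 hw)
        rw [← hsink w hw', ← (h w).2, R.finrank_sink hw']
      have h3 := hsource z hz
      rw [← (h z).2, ← h2, ← Nat.cast_sum, ← h1] at h3
      push_cast at h3
      linarith

end Reflection

end Existence

/-! ### Indecomposable representations -/

section Indecomposable

variable {k : Type u} [Field k] {V : Type v} {Ω Ω' : Digraph V}
variable {G : SimpleGraph V}

open DigraphRep

/-- At a source `z`, the kernel of `M_z → ⨁ M_w` is a direct summand of `M`. Hence the map is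
injective, unless `M` is concentrated at `z`. -/
theorem DigraphRep.IsIndecomposable.outMap_injective (hΩ : IsBipartiteOrientation G Ω)
    (hN : ∀ z, ∃ w, G.Adj z w) {M : DigraphRep k Ω} (hM : M.IsIndecomposable)
    (hw : ∃ w, IsSink Ω w ∧ Nontrivial (M.space w)) {z : V} (hz : IsSource Ω z) :
    Function.Injective (M.outMap G z) := by
  classical
  obtain ⟨w, hw, hwn⟩ := hw
  choose C hC using fun a => (LinearMap.ker (M.outMap G a)).exists_isCompl
  let U : M.Sub :=
    { space := fun a => if a = z then LinearMap.ker (M.outMap G a) else ⊥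
      map_mem := fun {a b} h m hm => by
        suffices M.map h m = 0 by rw [this]; exact zero_mem _
        split_ifs at hm with ha
        · have := congrFun (LinearMap.mem_ker.1 hm) ⟨b, hΩ.adj h⟩
          rwa [outMap_apply, M.tmap_of_adj h] at this
        · rw [(Submodule.mem_bot k).1 hm, map_zero] }
  let W : M.Sub :=
    { space := fun a => if a = z then C a else ⊤
      map_mem := fun {a b} h m hm => by
        have hb : b ≠ z := fun hb => hz a (hb ▸ h)
        simp [hb] }
  rcases hM.2 U W (fun a => by
    by_cases ha : a = z
    · simpa [U, W, ha] using hC a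
    · simpa [U, W, ha] using isCompl_bot_top) with h | h
  · have := h z
    simp only [U, if_true] at this
    exact LinearMap.ker_eq_bot.1 this
  · have hwz : w ≠ z := fun h => hΩ.not_isSource hN hw (h ▸ hz)
    have := h w
    simp only [W, if_neg hwz] at this
    exact absurd this top_ne_bot

variable [G.LocallyFinite]

/-- At a sink `z`, a complement of the image of `⨁ M_w → M_z` is a direct summand of `M`. Hence
the map is surjective, unless `M` is concentrated at `z`. -/
theorem DigraphRep.IsIndecomposable.sumMap_surjective (hΩ : IsBipartiteOrientation G Ω)
    (hN : ∀ z, ∃ w, G.Adj z w) {M : DigraphRep k Ω} (hM : M.IsIndecomposable)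
    (hw : ∃ w, IsSource Ω w ∧ Nontrivial (M.space w)) {z : V} (hz : IsSink Ω z) :
    Function.Surjective (M.sumMap G z) := by
  classical
  obtain ⟨w, hw, hwn⟩ := hw
  choose C hC using fun a => (LinearMap.range (M.sumMap G a)).exists_isCompl
  let U : M.Sub :=
    { space := fun a => if a = z then C a else ⊥
      map_mem := fun {a b} h m hm => by
        have ha : a ≠ z := fun ha => hz b (ha ▸ h)
        rw [if_neg ha, Submodule.mem_bot] at hm
        rw [hm, map_zero]
        exact zero_mem _ }
  let W : M.Sub :=
    { space := fun a => if a = z then LinearMap.range (M.sumMap G a) else ⊤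
      map_mem := fun {a b} h m hm => by
        split_ifs with hb
        · refine ⟨Pi.single ⟨a, (hΩ.adj h).symm⟩ m, ?_⟩
          rw [← M.tmap_of_adj h]
          exact M.sumMap_single G b ⟨a, (hΩ.adj h).symm⟩ m
        · trivial }
  rcases hM.2 U W (fun a => by
    by_cases ha : a = z
    · simpa [U, W, ha] using (hC a).symm
    · simpa [U, W, ha] using isCompl_bot_top) with h | h
  · have := h z
    simp only [U, if_true] at this
    have h2 := (hC z).codisjoint.eq_top
    rw [this, sup_bot_eq] at h2
    exact LinearMap.range_eq_top.1 h2
  · have hwz : w ≠ z := fun h => hΩ.not_isSource hN hz (h ▸ hw)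
    have := h w
    simp only [W, if_neg hwz] at this
    exact absurd this top_ne_bot

namespace Reflection

variable {M : DigraphRep k Ω} {N : DigraphRep k Ω'}

open Classical in
/-- The subrepresentation of `M` corresponding to a subrepresentation of `N`. -/
noncomputable def subDown (hΩ : IsBipartiteOrientation G Ω) (R : Reflection G M N) (U : N.Sub) :
    M.Sub where
  space z := (if IsSink Ω z then (U.space z).comap (R.e z) else ⊤) ⊓
    ⨅ w : G.neighborSet z, (U.space w).comap (R.e w ∘ₗ M.tmap z w)
  map_mem := fun {a b} h m hm => by
    have hb := hΩ.isSink_right h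
    rw [Submodule.mem_inf, Submodule.mem_iInf] at hm ⊢
    refine ⟨?_, fun w => ?_⟩
    · have := hm.2 ⟨b, hΩ.adj h⟩
      rw [Submodule.mem_comap, LinearMap.comp_apply, M.tmap_of_adj h] at this
      rwa [if_pos hb]
    · rw [Submodule.mem_comap, LinearMap.comp_apply, M.tmap_of_not_adj (hb w)]
      simp

theorem mem_subDown_of_isSink (hΩ : IsBipartiteOrientation G Ω) (R : Reflection G M N)
    (U : N.Sub) {z : V} (hz : IsSink Ω z) (m : M.space z) :
    m ∈ (R.subDown hΩ U).space z ↔ R.e z m ∈ U.space z := by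
  simp [subDown, if_pos hz, M.tmap_of_not_adj (hz _)]

theorem mem_subDown_of_isSource (hΩ : IsBipartiteOrientation G Ω) (hN : ∀ z, ∃ w, G.Adj z w)
    (R : Reflection G M N) (U : N.Sub) {z : V} (hz : IsSource Ω z) (m : M.space z) :
    m ∈ (R.subDown hΩ U).space z ↔
      ∀ w : G.neighborSet z, R.e w (M.tmap z w m) ∈ U.space w := by
  simp only [subDown, if_neg (hΩ.not_isSink hN hz), Submodule.mem_inf, Submodule.mem_top,
    true_and, Submodule.mem_iInf, Submodule.mem_comap, LinearMap.comp_apply]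

/-- A decomposition of `N` splits each family of elements of `M` at the sinks around `z`. -/
theorem exists_split (hΩ : IsBipartiteOrientation G Ω) (R : Reflection G M N) {U W : N.Sub}
    (h : ∀ z, IsCompl (U.space z) (W.space z)) {z : V} (hz : IsSource Ω z)
    (m : ∀ w : G.neighborSet z, M.space w) :
    ∃ p q : ∀ w : G.neighborSet z, M.space w, m = p + q ∧
      (∀ w : G.neighborSet z, R.e w (p w) ∈ U.space w) ∧
      ∀ w : G.neighborSet z, R.e w (q w) ∈ W.space w := by
  have : ∀ w : G.neighborSet z, ∃ p q : M.space w, m w = p + q ∧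
      R.e w p ∈ U.space w ∧ R.e w q ∈ W.space w := by
    intro w
    have hw := R.bij w (hΩ.isSink_of_adj hz w.2)
    obtain ⟨a, ha, b, hb, hab⟩ := Submodule.mem_sup.1
      ((h w).codisjoint.eq_top ▸ Submodule.mem_top : R.e w (m w) ∈ U.space w ⊔ W.space w)
    obtain ⟨p, rfl⟩ := hw.2 a
    obtain ⟨q, rfl⟩ := hw.2 b
    exact ⟨p, q, hw.1 (by rw [← hab, map_add]), ha, hb⟩
  choose p q h1 h2 h3 using this
  exact ⟨p, q, funext h1, h2, h3⟩

theorem isCompl_subDown (hΩ : IsBipartiteOrientation G Ω) (hN : ∀ z, ∃ w, G.Adj z w)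
    (R : Reflection G M N) {U W : N.Sub} (h : ∀ z, IsCompl (U.space z) (W.space z)) (z : V) :
    IsCompl ((R.subDown hΩ U).space z) ((R.subDown hΩ W).space z) := by
  rcases hΩ.sink_or_source z with hz | hz
  · constructor
    · rw [Submodule.disjoint_def]
      intro m h1 h2
      rw [mem_subDown_of_isSink hΩ R _ hz] at h1 h2
      have := Submodule.disjoint_def.1 (h z).disjoint _ h1 h2
      rwa [map_eq_zero_iff _ (R.bij z hz).1] at this
    · rw [codisjoint_iff, eq_top_iff]
      intro m _
      obtain ⟨a, ha, b, hb, hab⟩ := Submodule.mem_sup.1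
        ((h z).codisjoint.eq_top ▸ Submodule.mem_top : R.e z m ∈ U.space z ⊔ W.space z)
      obtain ⟨p, rfl⟩ := (R.bij z hz).2 a
      obtain ⟨q, rfl⟩ := (R.bij z hz).2 b
      exact Submodule.mem_sup.2 ⟨p, (mem_subDown_of_isSink hΩ R _ hz _).2 ha, q,
        (mem_subDown_of_isSink hΩ R _ hz _).2 hb, (R.bij z hz).1 (by rw [← hab, map_add])⟩
  · constructor
    · rw [Submodule.disjoint_def]
      intro m h1 h2
      rw [mem_subDown_of_isSource hΩ hN R _ hz] at h1 h2
      apply R.inj z hz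
      rw [map_zero]
      funext w
      have := Submodule.disjoint_def.1 (h w).disjoint _ (h1 w) (h2 w)
      rwa [map_eq_zero_iff _ (R.bij w (hΩ.isSink_of_adj hz w.2)).1] at this
    · rw [codisjoint_iff, eq_top_iff]
      intro m _
      obtain ⟨p, q, hpq, hp, hq⟩ := R.exists_split hΩ h hz (M.outMap G z m)
      have h0 : gather G R.e z p + gather G R.e z q = 0 := by
        rw [← map_add, ← hpq]
        exact (R.exact z hz _).2 ⟨m, rfl⟩
      have hU := gather_mem R.e U z hp
      have hW := gather_mem R.e W z hq
      have hp0 : gather G R.e z p = 0 :=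
        Submodule.disjoint_def.1 (h z).disjoint _ hU
          (by rw [eq_neg_of_add_eq_zero_left h0]; exact neg_mem hW)
      have hq0 : gather G R.e z q = 0 := by rwa [hp0, zero_add] at h0
      obtain ⟨m1, rfl⟩ := (R.exact z hz _).1 hp0
      obtain ⟨m2, rfl⟩ := (R.exact z hz _).1 hq0
      exact Submodule.mem_sup.2 ⟨m1, (mem_subDown_of_isSource hΩ hN R _ hz _).2 hp, m2,
        (mem_subDown_of_isSource hΩ hN R _ hz _).2 hq,
        R.inj z hz (by rw [map_add, ← hpq])⟩

theorem eq_bot_of_subDown_eq_bot (hΩ : IsBipartiteOrientation G Ω) (R : Reflection G M N)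
    {U W : N.Sub} (h : ∀ z, IsCompl (U.space z) (W.space z))
    (h0 : ∀ z, (R.subDown hΩ U).space z = ⊥) (z : V) : U.space z = ⊥ := by
  rw [eq_bot_iff]
  intro n hn
  rw [Submodule.mem_bot]
  have hs : ∀ w, IsSink Ω w → ∀ m, R.e w m ∈ U.space w → m = 0 := fun w hw m hm => by
    rwa [← mem_subDown_of_isSink hΩ R U hw, h0 w, Submodule.mem_bot] at hm
  rcases hΩ.sink_or_source z with hz | hz
  · obtain ⟨m, rfl⟩ := (R.bij z hz).2 n
    rw [hs z hz m hn, map_zero]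
  · obtain ⟨m, rfl⟩ := R.surj z hz n
    obtain ⟨p, q, rfl, hp, hq⟩ := R.exists_split hΩ h hz m
    have : p = 0 := funext fun w => hs w (hΩ.isSink_of_adj hz w.2) _ (hp w)
    rw [this, zero_add] at hn ⊢
    exact Submodule.disjoint_def.1 (h z).disjoint _ hn (gather_mem R.e W z hq)

/-- Reflection at the sources preserves indecomposability. -/
theorem isIndecomposable_up (hΩ : IsBipartiteOrientation G Ω) (hN : ∀ z, ∃ w, G.Adj z w)
    (R : Reflection G M N) (hM : M.IsIndecomposable) : N.IsIndecomposable := by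
  refine ⟨?_, fun U W h => ?_⟩
  · have hs : ∀ w, IsSink Ω w → Nontrivial (M.space w) → Nontrivial (N.space w) :=
      fun w hw _ => (R.bij w hw).1.nontrivial
    obtain ⟨z, hz'⟩ := hM.1
    rcases hΩ.sink_or_source z with hz | hz
    · exact ⟨z, hs z hz hz'⟩
    · obtain ⟨m, hm⟩ := exists_ne (0 : M.space z)
      have : M.outMap G z m ≠ 0 := fun h => hm (R.inj z hz (by rw [h, map_zero]))
      obtain ⟨w, hw⟩ := Function.ne_iff.1 this
      exact ⟨w, hs w (hΩ.isSink_of_adj hz w.2) ⟨_, _, hw⟩⟩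
  · rcases hM.2 _ _ (R.isCompl_subDown hΩ hN h) with h0 | h0
    · exact Or.inl (R.eq_bot_of_subDown_eq_bot hΩ h h0)
    · exact Or.inr (R.eq_bot_of_subDown_eq_bot hΩ (fun z => (h z).symm) h0)

open Classical in
/-- The subrepresentation of `N` corresponding to a subrepresentation of `M`. -/
noncomputable def subUp (hΩ : IsBipartiteOrientation G Ω) (hop : Opposite Ω Ω')
    (hN : ∀ z, ∃ w, G.Adj z w) (R : Reflection G M N) (U : M.Sub) : N.Sub where
  space z := if IsSink Ω z then (U.space z).map (R.e z) else
    (Submodule.pi Set.univ fun w : G.neighborSet z => U.space w).map (gather G R.e z)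
  map_mem := fun {a b} h n hn => by
    have hab := (hop a b).1 h
    rw [if_pos (hΩ.isSink_right hab)] at hn
    obtain ⟨m, hm, rfl⟩ := hn
    rw [if_neg (hΩ.not_isSink hN (hΩ.isSource_left hab))]
    refine ⟨Pi.single ⟨a, hΩ.adj hab⟩ m, fun w _ => ?_, ?_⟩
    · by_cases hw : w = ⟨a, hΩ.adj hab⟩
      · subst hw
        simpa using hm
      · rw [Pi.single_eq_of_ne hw]
        exact zero_mem _
    · rw [← N.tmap_of_adj h]
      exact gather_single R.e b ⟨a, hΩ.adj hab⟩ m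

theorem mem_subUp_of_isSink (hΩ : IsBipartiteOrientation G Ω) (hop : Opposite Ω Ω')
    (hN : ∀ z, ∃ w, G.Adj z w) (R : Reflection G M N) (U : M.Sub) {z : V} (hz : IsSink Ω z)
    (n : N.space z) :
    n ∈ (R.subUp hΩ hop hN U).space z ↔ ∃ m ∈ U.space z, R.e z m = n := by
  simp [subUp, if_pos hz]

theorem mem_subUp_of_isSource (hΩ : IsBipartiteOrientation G Ω) (hop : Opposite Ω Ω')
    (hN : ∀ z, ∃ w, G.Adj z w) (R : Reflection G M N) (U : M.Sub) {z : V} (hz : IsSource Ω z)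
    (n : N.space z) :
    n ∈ (R.subUp hΩ hop hN U).space z ↔ ∃ m : ∀ w : G.neighborSet z, M.space w,
      (∀ w : G.neighborSet z, m w ∈ U.space w) ∧ gather G R.e z m = n := by
  simp only [subUp, if_neg (hΩ.not_isSink hN hz), Submodule.mem_map,
    Submodule.mem_pi, Set.mem_univ, true_imp_iff]

theorem isCompl_subUp (hΩ : IsBipartiteOrientation G Ω) (hop : Opposite Ω Ω')
    (hN : ∀ z, ∃ w, G.Adj z w) (R : Reflection G M N) {U W : M.Sub}
    (h : ∀ z, IsCompl (U.space z) (W.space z)) (z : V) :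
    IsCompl ((R.subUp hΩ hop hN U).space z) ((R.subUp hΩ hop hN W).space z) := by
  have hsplit : ∀ z (m : M.space z), ∃ p ∈ U.space z, ∃ q ∈ W.space z, p + q = m := fun z m =>
    Submodule.mem_sup.1 ((h z).codisjoint.eq_top ▸ Submodule.mem_top)
  rcases hΩ.sink_or_source z with hz | hz
  · constructor
    · rw [Submodule.disjoint_def]
      intro n h1 h2
      rw [mem_subUp_of_isSink hΩ hop hN R _ hz] at h1 h2
      obtain ⟨p, hp, rfl⟩ := h1
      obtain ⟨q, hq, hpq⟩ := h2
      obtain rfl := (R.bij z hz).1 hpq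
      rw [Submodule.disjoint_def.1 (h z).disjoint _ hp hq, map_zero]
    · rw [codisjoint_iff, eq_top_iff]
      intro n _
      obtain ⟨m, rfl⟩ := (R.bij z hz).2 n
      obtain ⟨p, hp, q, hq, rfl⟩ := hsplit z m
      exact Submodule.mem_sup.2 ⟨_, (mem_subUp_of_isSink hΩ hop hN R _ hz _).2 ⟨p, hp, rfl⟩, _,
        (mem_subUp_of_isSink hΩ hop hN R _ hz _).2 ⟨q, hq, rfl⟩, (map_add _ _ _).symm⟩
  · constructor
    · rw [Submodule.disjoint_def]
      intro n h1 h2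
      rw [mem_subUp_of_isSource hΩ hop hN R _ hz] at h1 h2
      obtain ⟨p, hp, rfl⟩ := h1
      obtain ⟨q, hq, hpq⟩ := h2
      obtain ⟨m, hm⟩ := (R.exact z hz (p - q)).1 (by rw [map_sub, hpq, sub_self])
      obtain ⟨a, ha, b, hb, rfl⟩ := hsplit z m
      -- `p` is the image of `a`, because `p - a = q + b` lies in both summands
      refine (R.exact z hz _).2 ⟨a, funext fun w => ?_⟩
      have hw : M.tmap z w a + M.tmap z w b = p w - q w := by
        rw [← map_add]; exact congrFun hm w
      have e : p w - M.tmap z w a = M.tmap z w b + q w := by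
        rw [sub_eq_iff_eq_add, add_right_comm, add_comm (M.tmap z w b), hw, sub_add_cancel]
      have h3 := Submodule.disjoint_def.1 (h w).disjoint (p w - M.tmap z w a)
        (sub_mem (hp w) (U.tmap_mem _ _ ha))
        (by rw [e]; exact add_mem (W.tmap_mem _ _ hb) (hq w))
      exact (sub_eq_zero.1 h3).symm
    · rw [codisjoint_iff, eq_top_iff]
      intro n _
      obtain ⟨m, rfl⟩ := R.surj z hz n
      choose p hp q hq hpq using fun w : G.neighborSet z => hsplit w (m w)
      refine Submodule.mem_sup.2 ⟨_, (mem_subUp_of_isSource hΩ hop hN R _ hz _).2 ⟨p, hp, rfl⟩,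
        _, (mem_subUp_of_isSource hΩ hop hN R _ hz _).2 ⟨q, hq, rfl⟩, ?_⟩
      rw [← map_add]
      exact congrArg _ (funext hpq)

theorem eq_bot_of_subUp_eq_bot (hΩ : IsBipartiteOrientation G Ω) (hop : Opposite Ω Ω')
    (hN : ∀ z, ∃ w, G.Adj z w) (R : Reflection G M N) {U : M.Sub}
    (h0 : ∀ z, (R.subUp hΩ hop hN U).space z = ⊥) (z : V) : U.space z = ⊥ := by
  have hs : ∀ w, IsSink Ω w → ∀ m ∈ U.space w, m = 0 := fun w hw m hm => by
    have := (mem_subUp_of_isSink hΩ hop hN R U hw _).2 ⟨m, hm, rfl⟩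
    rwa [h0 w, Submodule.mem_bot, map_eq_zero_iff _ (R.bij w hw).1] at this
  rw [eq_bot_iff]
  intro m hm
  rw [Submodule.mem_bot]
  rcases hΩ.sink_or_source z with hz | hz
  · exact hs z hz m hm
  · apply R.inj z hz
    rw [map_zero]
    exact funext fun w => hs w (hΩ.isSink_of_adj hz w.2) _ (U.tmap_mem _ _ hm)

/-- Reflection at the sinks preserves indecomposability. -/
theorem isIndecomposable_down (hΩ : IsBipartiteOrientation G Ω) (hop : Opposite Ω Ω')
    (hN : ∀ z, ∃ w, G.Adj z w) (R : Reflection G M N) (hNi : N.IsIndecomposable) :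
    M.IsIndecomposable := by
  refine ⟨?_, fun U W h => ?_⟩
  · obtain ⟨z, hz'⟩ := hNi.1
    obtain ⟨n, hn⟩ := exists_ne (0 : N.space z)
    rcases hΩ.sink_or_source z with hz | hz
    · obtain ⟨m, rfl⟩ := (R.bij z hz).2 n
      exact ⟨z, m, 0, fun h => hn (by rw [h, map_zero])⟩
    · obtain ⟨m, rfl⟩ := R.surj z hz n
      have : m ≠ 0 := fun h => hn (by rw [h, map_zero])
      obtain ⟨w, hw⟩ := Function.ne_iff.1 this
      exact ⟨w, _, _, hw⟩
  · rcases hNi.2 _ _ (R.isCompl_subUp hΩ hop hN h) with h0 | h0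
    · exact Or.inl (R.eq_bot_of_subUp_eq_bot hΩ hop hN h0)
    · exact Or.inr (R.eq_bot_of_subUp_eq_bot hΩ hop hN h0)

end Reflection

end Indecomposable

/-! ### Iterated reflections of dimension vectors -/

section Iteration

variable {V : Type v} {G : SimpleGraph V} {Ω Ω' : Digraph V}

theorem IsOrientationAt.succ {t : ℕ} {x : V} (h : IsOrientationAt G Ω t x)
    (hop : Opposite Ω Ω') : IsOrientationAt G Ω' (t + 1) x where
  bipartite := h.bipartite.opposite hop
  sink ht := (hop.isSink_iff x).2 (h.source (by grind))
  source ht := (hop.isSource_iff x).2 (h.sink (by grind))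

theorem IsOrientationAt.pred {t : ℕ} {x : V} (h : IsOrientationAt G Ω (t + 1) x)
    (hop : Opposite Ω Ω') : IsOrientationAt G Ω' t x where
  bipartite := h.bipartite.opposite hop
  sink ht := (hop.isSink_iff x).2 (h.source (by grind))
  source ht := (hop.isSource_iff x).2 (h.sink (by grind))

theorem IsOrientationAt.sink_zero {x : V} (h : IsOrientationAt G Ω 0 x) : IsSink Ω x :=
  h.sink Even.zero

theorem IsOrientationAt.source_one {x : V} (h : IsOrientationAt G Ω 1 x) : IsSource Ω x :=
  h.source odd_one

theorem IsBipartiteOrientation.parity_of_walk (hΩ : IsBipartiteOrientation G Ω) {a b : V}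
    (p : G.Walk a b) :
    (IsSink Ω a → (Even p.length → IsSink Ω b) ∧ (Odd p.length → IsSource Ω b)) ∧
    (IsSource Ω a → (Even p.length → IsSource Ω b) ∧ (Odd p.length → IsSink Ω b)) := by
  induction p with
  | nil => simp
  | cons h p ih =>
    have h1 := fun ha => ih.2 (hΩ.isSource_of_adj ha h)
    have h2 := fun ha => ih.1 (hΩ.isSink_of_adj ha h)
    rw [SimpleGraph.Walk.length_cons]
    grind

theorem IsBipartiteOrientation.parity (hΩ : IsBipartiteOrientation G Ω) (hG : G.Connected)
    (a b : V) :
    (IsSink Ω a → (Even (G.dist a b) → IsSink Ω b) ∧ (Odd (G.dist a b) → IsSource Ω b)) ∧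
    (IsSource Ω a → (Even (G.dist a b) → IsSource Ω b) ∧ (Odd (G.dist a b) → IsSink Ω b)) := by
  obtain ⟨p, hp⟩ := hG.exists_walk_length_eq_dist a b
  rw [← hp]
  exact hΩ.parity_of_walk p

variable [G.LocallyFinite]

theorem iterReflection_succ_of_isSink (hG : G.Connected) (hN : ∀ z, ∃ w, G.Adj z w) {t : ℕ}
    {x : V} (h : IsOrientationAt G Ω t x) (a : V → ℤ) {z : V} (hz : IsSink Ω z) :
    iterReflection G x a (t + 1) z = iterReflection G x a t z := by
  have hns := h.bipartite.not_isSource hN hz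
  have hp := h.bipartite.parity hG x z
  have h1 := h.sink
  have h2 := h.source
  rw [iterReflection]
  split_ifs with ht
  · rw [oddReflection, if_neg fun ho => hns ((hp.1 (h1 ht)).2 ho)]
  · rw [evenReflection, if_neg fun ho => hns ((hp.2 (h2 (Nat.not_even_iff_odd.1 ht))).1 ho)]

theorem iterReflection_succ_of_isSource (hG : G.Connected) (hN : ∀ z, ∃ w, G.Adj z w) {t : ℕ}
    {x : V} (h : IsOrientationAt G Ω t x) (a : V → ℤ) {z : V} (hz : IsSource Ω z) :
    iterReflection G x a (t + 1) z = -iterReflection G x a t z +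
      ∑ w ∈ G.neighborFinset z, iterReflection G x a t w := by
  have hns := h.bipartite.not_isSink hN hz
  have hp := h.bipartite.parity hG x z
  have h1 := h.sink
  have h2 := h.source
  rw [iterReflection]
  split_ifs with ht
  · rw [oddReflection, if_pos (Nat.not_even_iff_odd.1 fun ho => hns ((hp.1 (h1 ht)).1 ho))]
    simp [reflection]
  · rw [evenReflection, if_pos (Nat.not_odd_iff_even.1 fun ho =>
      hns ((hp.2 (h2 (Nat.not_even_iff_odd.1 ht))).2 ho))]
    simp [reflection]

end Iteration

/-! ### Sums over the sinks and Fibonacci numbers -/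

section Sums

variable {V : Type v} {G : SimpleGraph V} {Ω Ω' : Digraph V}

/-- The sum of the coordinates of a vector at the sinks. -/
noncomputable def sinkSum (Ω : Digraph V) (a : V → ℤ) : ℤ := ∑ᶠ z ∈ {z | IsSink Ω z}, a z

open Classical in
theorem sinkSum_eq_sum {a : V → ℤ} {F : Finset V} (hF : Function.support a ⊆ F) :
    sinkSum Ω a = ∑ z ∈ F with IsSink Ω z, a z := by
  refine finsum_mem_eq_sum_of_inter_support_eq _ ?_
  ext z
  have := @hF z
  simp only [Set.mem_inter_iff, Set.mem_ofPred_eq, Finset.coe_filter] at *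
  tauto

theorem cast_sinkDim {k : Type u} [Field k] {M : DigraphRep k Ω} {d : V → ℤ}
    (hM : M.HasDimVector d) (hd : (Function.support d).Finite) :
    (M.sinkDim : ℤ) = sinkSum Ω d := by
  classical
  rw [sinkSum_eq_sum (F := hd.toFinset) (by simp), DigraphRep.sinkDim,
    finsum_mem_eq_sum_of_inter_support_eq (t := {z ∈ hd.toFinset | IsSink Ω z}),
    Nat.cast_sum]
  · exact Finset.sum_congr rfl fun z _ => (hM z).2
  · ext z
    have := (hM z).2
    simp only [Set.mem_inter_iff, Set.mem_ofPred_eq, Finset.coe_filter, Set.Finite.mem_toFinset,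
      Function.mem_support, ← this, ne_eq, Nat.cast_eq_zero]
    tauto

/-- The basis vector at a vertex. -/
noncomputable def vertexVec (x : V) : V → ℤ := open Classical in Pi.single x 1

theorem vertexVec_self (x : V) : vertexVec x x = 1 := by simp [vertexVec]

theorem vertexVec_of_ne {x z : V} (h : z ≠ x) : vertexVec x z = 0 := by simp [vertexVec, h]

theorem finite_support_vertexVec (x : V) : (Function.support (vertexVec x)).Finite :=
  (Set.finite_singleton x).subset fun z hz => by
    by_contra h
    exact hz (vertexVec_of_ne h)

theorem sinkSum_vertexVec_of_isSink {x : V} (hx : IsSink Ω x) :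
    sinkSum Ω (vertexVec x) = 1 := by
  rw [sinkSum, finsum_eq_single _ x fun z hz => by simp [vertexVec_of_ne hz]]
  simp [hx, vertexVec_self]

theorem sinkSum_vertexVec_of_not_isSink {x : V} (hx : ¬ IsSink Ω x) :
    sinkSum Ω (vertexVec x) = 0 :=
  finsum_mem_eq_zero_of_forall_eq_zero fun _ hz => vertexVec_of_ne fun h => hx (h ▸ hz)

theorem sinkSum_add {a b : V → ℤ} (ha : (Function.support a).Finite)
    (hb : (Function.support b).Finite) : sinkSum Ω (a + b) = sinkSum Ω a + sinkSum Ω b :=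
  finsum_mem_add_distrib' (ha.inter_of_right _) (hb.inter_of_right _)

theorem cast_fib_add_four (n : ℕ) :
    (Nat.fib (n + 4) : ℤ) = 3 * Nat.fib (n + 2) - Nat.fib n := by
  have h1 := Nat.fib_add_two (n := n)
  have h2 := Nat.fib_add_two (n := n + 1)
  have h3 := Nat.fib_add_two (n := n + 2)
  grind

variable [G.LocallyFinite]

/-- Reflecting at all sources of a 3-regular graph: each sink has three neighbours, all of which
are sources, so the sum `S` over the sinks and the sum `Q` over the sources become `Q' = S` (the
sinks are now sources) and `S' = 3 S - Q`. -/
theorem sinkSum_reflect (h3 : G.IsRegularOfDegree 3) (hΩ : IsBipartiteOrientation G Ω)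
    (hop : Opposite Ω Ω') {a a' : V → ℤ} (ha : (Function.support a).Finite)
    (hsink : ∀ z, IsSink Ω z → a' z = a z)
    (hsource : ∀ z, IsSource Ω z → a' z = -a z + ∑ w ∈ G.neighborFinset z, a w) :
    (Function.support a').Finite ∧ sinkSum Ω a' = sinkSum Ω a ∧
      sinkSum Ω' a' = 3 * sinkSum Ω a - sinkSum Ω' a := by
  classical
  set F := ha.toFinset with hF
  set F' := F ∪ F.biUnion fun w => G.neighborFinset w with hF'
  have hFa : ∀ w, w ∉ F → a w = 0 := fun w hw => by simpa [hF] using hw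
  have hsub : Function.support a ⊆ F := by simp [hF]
  have hsub' : Function.support a ⊆ F' := fun z hz =>
    Finset.mem_union_left _ (hsub hz)
  have hsup : Function.support a' ⊆ F' := by
    intro z hz
    by_contra hzF
    have h1 : z ∉ F := fun h => hzF (Finset.mem_union_left _ h)
    have h2 : ∀ w ∈ G.neighborFinset z, a w = 0 := fun w hw => hFa w fun h =>
      hzF (Finset.mem_union_right _ (Finset.mem_biUnion.2 ⟨w, h, by
        simpa [G.adj_comm] using hw⟩))
    apply hz
    rcases hΩ.sink_or_source z with hz' | hz'
    · rw [hsink z hz', hFa z h1]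
    · rw [hsource z hz', hFa z h1, Finset.sum_eq_zero h2]
      simp
  refine ⟨F'.finite_toSet.subset hsup, finsum_mem_congr rfl hsink, ?_⟩
  rw [sinkSum_eq_sum (Ω := Ω') hsup, sinkSum_eq_sum (Ω := Ω') hsub',
    sinkSum_eq_sum (Ω := Ω) hsub]
  -- `F` is the support of `a`, and `F'` adds its neighbours, where `a'` may be nonzero; restricting
  -- the inner sum to `F` makes both sums finite and interchangeable
  have e1 : ∑ z ∈ F' with IsSink Ω' z, a' z = ∑ z ∈ F' with IsSink Ω' z, -a z +
      ∑ z ∈ F' with IsSink Ω' z, ∑ w ∈ G.neighborFinset z with w ∈ F, a w := by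
    rw [← Finset.sum_add_distrib]
    refine Finset.sum_congr rfl fun z hz => ?_
    rw [hsource z ((hop.isSink_iff z).1 (Finset.mem_filter.1 hz).2)]
    congr 1
    refine (Finset.sum_filter_of_ne fun w _ hw => ?_).symm
    by_contra h
    exact hw (hFa w h)
  have e2 : ∑ z ∈ F' with IsSink Ω' z, ∑ w ∈ G.neighborFinset z with w ∈ F, a w =
      ∑ w ∈ F with IsSink Ω w, ∑ _z ∈ G.neighborFinset w, a w := by
    refine Finset.sum_comm' fun z w => ?_
    simp only [Finset.mem_filter, SimpleGraph.mem_neighborFinset, hop.isSink_iff]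
    constructor
    · rintro ⟨⟨-, hz⟩, hzw, hw⟩
      exact ⟨hzw.symm, hw, hΩ.isSink_of_adj hz hzw⟩
    · rintro ⟨hwz, hw, hws⟩
      refine ⟨⟨Finset.mem_union_right _ (Finset.mem_biUnion.2 ⟨w, hw, by simpa using hwz⟩), ?_⟩,
        hwz.symm, hw⟩
      exact hΩ.isSource_of_adj hws hwz
  have e3 : ∀ w, ∑ _z ∈ G.neighborFinset w, a w = 3 * a w := fun w => by
    rw [Finset.sum_const, G.card_neighborFinset_eq_degree, h3 w, nsmul_eq_mul]
    rfl
  rw [e1, e2, Finset.sum_neg_distrib, Finset.sum_congr rfl fun w _ => e3 w, ← Finset.mul_sum]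
  ring

/-- If `S` satisfies the recursion of every second Fibonacci number, and describes the sums over
the sinks and over the sources of `a` initially, then `S t` is the sum over the sinks at
stage `t`. The sum over the sources at stage `t` is `S (t - 1)`, written as `3 S t - S (t + 1)` in
order to include `t = 0`. -/
theorem sinkSum_iterReflection (hG : G.Connected) (h3 : G.IsRegularOfDegree 3)
    (hN : ∀ z, ∃ w, G.Adj z w) {x : V} {a : V → ℤ} (S : ℕ → ℤ)
    (hS : ∀ t, S (t + 2) = 3 * S (t + 1) - S t) (ha : (Function.support a).Finite)
    (h0 : ∀ Ω Ω' : Digraph V, IsOrientationAt G Ω 0 x → Opposite Ω Ω' →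
      sinkSum Ω a = S 0 ∧ sinkSum Ω' a = 3 * S 0 - S 1) (t : ℕ) :
    ∀ Ω Ω' : Digraph V, IsOrientationAt G Ω t x → Opposite Ω Ω' →
      (Function.support (iterReflection G x a t)).Finite ∧
      sinkSum Ω (iterReflection G x a t) = S t ∧
      sinkSum Ω' (iterReflection G x a t) = 3 * S t - S (t + 1) := by
  induction t with
  | zero => exact fun Ω Ω' h hop => ⟨ha, h0 Ω Ω' h hop⟩
  | succ t ih =>
    intro Ω Ω' h hop
    obtain ⟨h1, h2, h3'⟩ := ih Ω' Ω (h.pred hop) hop.symm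
    have h' := h.pred hop
    obtain ⟨r1, r2, r3⟩ := sinkSum_reflect h3 h'.bipartite hop.symm h1
      (fun z hz => iterReflection_succ_of_isSink hG hN h' a hz)
      (fun z hz => iterReflection_succ_of_isSource hG hN h' a hz)
    refine ⟨r1, ?_, ?_⟩
    · rw [r3, h2, h3']; ring
    · rw [r2, h2, hS]; ring

theorem sinkSum_vertexVec_iterReflection (hG : G.Connected) (h3 : G.IsRegularOfDegree 3)
    (hN : ∀ z, ∃ w, G.Adj z w) {x : V} {t : ℕ} (hΩ : IsOrientationAt G Ω t x) :
    (Function.support (iterReflection G x (vertexVec x) t)).Finite ∧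
      sinkSum Ω (iterReflection G x (vertexVec x) t) = Nat.fib (2 * t + 2) := by
  obtain ⟨Ω', hop⟩ := exists_opposite Ω
  have := sinkSum_iterReflection hG h3 hN (x := x) (a := vertexVec x)
    (fun t => Nat.fib (2 * t + 2)) (fun t => cast_fib_add_four (2 * t + 2))
    (finite_support_vertexVec x) (fun Ω Ω' h hop => by
      rw [sinkSum_vertexVec_of_isSink h.sink_zero, sinkSum_vertexVec_of_not_isSink fun hx =>
        h.bipartite.not_isSource hN h.sink_zero ((hop.isSink_iff x).1 hx)]
      norm_num [Nat.fib_add_two]) t Ω Ω' hΩ hop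
  exact ⟨this.1, this.2.1⟩

theorem sinkSum_edge_iterReflection (hG : G.Connected) (h3 : G.IsRegularOfDegree 3)
    (hN : ∀ z, ∃ w, G.Adj z w) {x y : V} (hxy : G.Adj x y) {t : ℕ}
    (hΩ : IsOrientationAt G Ω t x) :
    (Function.support (iterReflection G x (vertexVec x + vertexVec y) t)).Finite ∧
      sinkSum Ω (iterReflection G x (vertexVec x + vertexVec y) t) = Nat.fib (2 * t + 1) := by
  obtain ⟨Ω', hop⟩ := exists_opposite Ω
  have := sinkSum_iterReflection hG h3 hN (x := x) (a := vertexVec x + vertexVec y)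
    (fun t => Nat.fib (2 * t + 1)) (fun t => cast_fib_add_four (2 * t + 1))
    (((finite_support_vertexVec x).union (finite_support_vertexVec y)).subset
      (Function.support_add _ _)) (fun Ω Ω' h hop => by
      have hy := h.bipartite.isSource_of_adj h.sink_zero hxy
      rw [sinkSum_add (finite_support_vertexVec x) (finite_support_vertexVec y),
        sinkSum_add (finite_support_vertexVec x) (finite_support_vertexVec y),
        sinkSum_vertexVec_of_isSink h.sink_zero,
        sinkSum_vertexVec_of_isSink ((hop.isSink_iff y).2 hy),
        sinkSum_vertexVec_of_not_isSink (h.bipartite.not_isSink hN hy),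
        sinkSum_vertexVec_of_not_isSink fun hx =>
        h.bipartite.not_isSource hN h.sink_zero ((hop.isSink_iff x).1 hx)]
      norm_num [Nat.fib_add_two]) t Ω Ω' hΩ hop
  exact ⟨this.1, this.2.1⟩

/-- If the sum over the sinks is not zero, then neither are all the coordinates at the sinks. -/
theorem exists_ne_zero_of_sinkSum_ne_zero {a : V → ℤ} (h : sinkSum Ω a ≠ 0) :
    ∃ w, IsSink Ω w ∧ a w ≠ 0 := by
  by_contra! h0
  exact h (finsum_mem_eq_zero_of_forall_eq_zero h0)

end Sums

/-! ### Reflected indecomposable representations -/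

section Reflected

variable {k : Type u} [Field k] {V : Type v} {Ω Ω' : Digraph V}
variable {G : SimpleGraph V} [G.LocallyFinite]

open DigraphRep

/-- `M` is an indecomposable representation of `(G, Ω^x_t)` whose dimension vector arises
from `a` by `t` reflections. For suitable `a` these are the representations `P_t(x)`
and `R_t(x,y)`. -/
structure IsReflected (G : SimpleGraph V) [G.LocallyFinite] (a : V → ℤ) (t : ℕ) (x : V)
    (M : DigraphRep k Ω) : Prop where
  orientation : IsOrientationAt G Ω t x
  indecomposable : M.IsIndecomposable
  dimVector : M.HasDimVector (iterReflection G x a t)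

theorem isP_iff {t : ℕ} {x : V} {M : DigraphRep k Ω} :
    IsP G t x M ↔ IsReflected G (vertexVec x) t x M :=
  ⟨fun h => ⟨h.1, h.2, h.3⟩, fun h => ⟨h.1, h.2, h.3⟩⟩

theorem isR_iff {t : ℕ} {x y : V} (hxy : G.Adj x y) {M : DigraphRep k Ω} :
    IsR G t x y M ↔ IsReflected G (vertexVec x + vertexVec y) t x M :=
  ⟨fun h => ⟨h.2, h.3, h.4⟩, fun h => ⟨hxy, h.1, h.2, h.3⟩⟩

/-- The vector `a` does not vanish at all sinks after any number of reflections. This ensures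
that the representations obtained from an indecomposable one with dimension vector `a` are
never concentrated at a vertex where the next reflection takes place. -/
def IsPersistent (G : SimpleGraph V) [G.LocallyFinite] (a : V → ℤ) (x : V) : Prop :=
  ∀ (Ω : Digraph V) (t : ℕ), IsOrientationAt G Ω t x →
    ∃ w, IsSink Ω w ∧ iterReflection G x a t w ≠ 0

theorem DigraphRep.HasDimVector.nontrivial {M : DigraphRep k Ω} {d : V → ℤ}
    (h : M.HasDimVector d) {z : V} (hz : d z ≠ 0) : Nontrivial (M.space z) := by
  have := (h z).1
  rw [← Module.finrank_pos_iff (R := k), Nat.pos_iff_ne_zero]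
  intro h0
  exact hz (by rw [← (h z).2, h0, Nat.cast_zero])

theorem DigraphRep.HasDimVector.subsingleton {M : DigraphRep k Ω} {d : V → ℤ}
    (h : M.HasDimVector d) {z : V} (hz : d z = 0) : Subsingleton (M.space z) := by
  have := (h z).1
  have h0 := (h z).2
  rw [hz, Nat.cast_eq_zero] at h0
  exact Module.finrank_zero_iff.1 h0

variable {a : V → ℤ} {x : V} {t : ℕ}

theorem IsReflected.exists_up (hG : G.Connected) (hN : ∀ z, ∃ w, G.Adj z w)
    (ha : IsPersistent G a x) (hop : Opposite Ω Ω') {M : DigraphRep k Ω}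
    (hM : IsReflected G a t x M) :
    ∃ N : DigraphRep k Ω', Nonempty (Reflection G M N) ∧ IsReflected G a (t + 1) x N := by
  have hΩ := hM.orientation.bipartite
  obtain ⟨w, hw, hw0⟩ := ha Ω t hM.orientation
  obtain ⟨N, ⟨R⟩⟩ := Reflection.exists_up hΩ hop hN M (fun z => (hM.dimVector z).1)
    fun z hz => hM.indecomposable.outMap_injective hΩ hN
      ⟨w, hw, hM.dimVector.nontrivial hw0⟩ hz
  exact ⟨N, ⟨R⟩, hM.orientation.succ hop, R.isIndecomposable_up hΩ hN hM.indecomposable,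
    (R.hasDimVector_iff hΩ
      (fun z hz => iterReflection_succ_of_isSink hG hN hM.orientation a hz)
      (fun z hz => iterReflection_succ_of_isSource hG hN hM.orientation a hz)).1 hM.dimVector⟩

theorem IsReflected.exists_down (hG : G.Connected) (hN : ∀ z, ∃ w, G.Adj z w)
    (ha : IsPersistent G a x) (hop : Opposite Ω Ω') {N : DigraphRep k Ω'}
    (h : IsReflected G a (t + 1) x N) :
    ∃ M : DigraphRep k Ω, Nonempty (Reflection G M N) ∧ IsReflected G a t x M := by
  have hM := h.orientation.pred hop.symm
  have hΩ := hM.bipartite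
  obtain ⟨w, hw, hw0⟩ := ha Ω t hM
  rw [← iterReflection_succ_of_isSink hG hN hM a hw] at hw0
  obtain ⟨M, ⟨R⟩⟩ := Reflection.exists_down hΩ hN N (fun z => (h.dimVector z).1)
    fun z hz => h.indecomposable.sumMap_surjective (hΩ.opposite hop) hN
      ⟨w, (hop.isSource_iff w).2 hw, h.dimVector.nontrivial hw0⟩ ((hop.isSink_iff z).2 hz)
  exact ⟨M, ⟨R⟩, hM, R.isIndecomposable_down hΩ hop hN h.indecomposable,
    (R.hasDimVector_iff hΩ
      (fun z hz => iterReflection_succ_of_isSink hG hN hM a hz)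
      (fun z hz => iterReflection_succ_of_isSource hG hN hM a hz)).2 h.dimVector⟩

variable (k) in
/-- Indecomposable representations of `(G, Ω^x_0)` with dimension vector `a` are unique up to
isomorphism. -/
def IsRigidVec (G : SimpleGraph V) [G.LocallyFinite] (a : V → ℤ) (x : V) : Prop :=
  ∀ (Ω : Digraph V) (M M' : DigraphRep k Ω), IsReflected G a 0 x M → IsReflected G a 0 x M' →
    Nonempty (Iso M M')

theorem IsReflected.nonempty_iso (hG : G.Connected) (hN : ∀ z, ∃ w, G.Adj z w)
    (ha : IsPersistent G a x) (hr : IsRigidVec k G a x) (t : ℕ) :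
    ∀ (Ω : Digraph V) (M M' : DigraphRep k Ω), IsReflected G a t x M → IsReflected G a t x M' →
      Nonempty (Iso M M') := by
  induction t with
  | zero => exact hr
  | succ t ih =>
    intro Ω N N' h h'
    obtain ⟨Ω', hop⟩ := exists_opposite Ω
    obtain ⟨M, ⟨R⟩, hM⟩ := h.exists_down hG hN ha hop.symm
    obtain ⟨M', ⟨R'⟩, hM'⟩ := h'.exists_down hG hN ha hop.symm
    obtain ⟨α⟩ := ih Ω' M M' hM hM'
    exact R.iso_up hM.orientation.bipartite hop.symm hN R' α

/-! ### Morphisms and short exact sequences -/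

/-- The space of morphisms `A → B` has dimension at most one. -/
def HomLine (A B : DigraphRep k Ω) : Prop :=
  ∀ f f' : Hom A B, (∃ z m, f.app z m ≠ 0) → ∃ c : k, ∀ z m, f'.app z m = c • f.app z m

theorem HomLine.up (hΩ : IsBipartiteOrientation G Ω) (hN : ∀ z, ∃ w, G.Adj z w)
    {A B : DigraphRep k Ω} {A' B' : DigraphRep k Ω'} (RA : Reflection G A A')
    (RB : Reflection G B B') (h : HomLine A B) : HomLine A' B' := by
  intro g g' hg
  obtain ⟨f, hf⟩ := RA.exists_hom_down hΩ hN RB g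
  obtain ⟨f', hf'⟩ := RA.exists_hom_down hΩ hN RB g'
  have hfne : ∃ z m, f.app z m ≠ 0 := by
    by_contra! h0
    obtain ⟨z, n, hn⟩ := hg
    refine hn ?_
    -- a morphism that vanishes at the sinks of `Ω` is `0` times itself there, hence everywhere
    have := RA.smul_ext hΩ g g 0 (fun w hw n => by
      obtain ⟨m, rfl⟩ := (RA.bij w hw).2 n
      rw [hf w hw, h0, map_zero, smul_zero]) z n
    rwa [zero_smul] at this
  obtain ⟨c, hc⟩ := h f f' hfne
  refine ⟨c, RA.smul_ext hΩ g g' c fun w hw n => ?_⟩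
  obtain ⟨m, rfl⟩ := (RA.bij w hw).2 n
  rw [hf w hw, hf' w hw, hc, map_smul]

theorem IsReflected.homLine (hG : G.Connected) (hN : ∀ z, ∃ w, G.Adj z w) {b : V → ℤ} {y : V}
    (ha : IsPersistent G a x) (hb : IsPersistent G b y) {i : ℕ}
    (h0 : ∀ (Ω : Digraph V) (A B : DigraphRep k Ω), IsReflected G a 0 x A →
      IsReflected G b i y B → HomLine A B) (t : ℕ) :
    ∀ (Ω : Digraph V) (A B : DigraphRep k Ω), IsReflected G a t x A →
      IsReflected G b (t + i) y B → HomLine A B := by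
  induction t with
  | zero => simpa using h0
  | succ t ih =>
    intro Ω A B hA hB
    rw [Nat.add_right_comm] at hB
    obtain ⟨Ω', hop⟩ := exists_opposite Ω
    obtain ⟨A', ⟨RA⟩, hA'⟩ := hA.exists_down hG hN ha hop.symm
    obtain ⟨B', ⟨RB⟩, hB'⟩ := hB.exists_down hG hN hb hop.symm
    exact (ih Ω' A' B' hA' hB').up hA'.orientation.bipartite hN RA RB

/-- If `Hom(A, B)` is at most one-dimensional, there is only one short exact sequence starting
with `A → B`: the two embeddings of `A` differ by a scalar, which an automorphism of `A`
absorbs, and the third isomorphism is induced on the cokernels. -/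
theorem seqIso_of_homLine {A B C A' B' C' : DigraphRep k Ω} (α₀ : Iso A A') (β : Iso B B')
    (hA : ∃ z, Nontrivial (A.space z)) (hl : HomLine A' B')
    (f : Hom A B) (g : Hom B C) (f' : Hom A' B') (g' : Hom B' C')
    (h : IsShortExact f g) (h' : IsShortExact f' g') : SeqIso f g f' g' := by
  let f₁ : Hom A' B' := (α₀.symm.hom.comp f).comp β.hom
  have hf₁ : ∀ z m, f₁.app z (α₀.app z m) = β.app z (f.app z m) := fun z m => by
    simp [f₁, Hom.comp, Iso.hom, Iso.symm]
  obtain ⟨z₀, hz₀⟩ := hA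
  obtain ⟨m₀, hm₀⟩ := exists_ne (0 : A.space z₀)
  have hne : ∃ z m, f'.app z m ≠ 0 := ⟨z₀, α₀.app z₀ m₀, by
    rw [Ne, map_eq_zero_iff _ (h' z₀).1, map_eq_zero_iff _ (α₀.app z₀).injective]
    exact hm₀⟩
  obtain ⟨c, hc⟩ := hl f' f₁ hne
  have hc0 : c ≠ 0 := by
    rintro rfl
    have := hc z₀ (α₀.app z₀ m₀)
    rw [hf₁, zero_smul, map_eq_zero_iff _ (β.app z₀).injective,
      map_eq_zero_iff _ (h z₀).1] at this
    exact hm₀ this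
  let α : Iso A A' :=
    ⟨fun z => (α₀.app z).trans (LinearEquiv.smulOfNeZero k _ c hc0), fun h m => by
      simp [α₀.comm]⟩
  have hα : ∀ z m, β.app z (f.app z m) = f'.app z (α.app z m) := fun z m => by
    rw [← hf₁, hc]
    simp [α]
  have key : ∀ z, ∃ γ : C.space z ≃ₗ[k] C'.space z,
      ∀ m, γ (g.app z m) = g'.app z (β.app z m) := by
    intro z
    obtain ⟨s, hs⟩ := (g.app z).exists_rightInverse_of_surjective
      (LinearMap.range_eq_top.2 (h z).2.2)
    let γ : C.space z →ₗ[k] C'.space z := g'.app z ∘ₗ (β.app z).toLinearMap ∘ₗ s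
    have hγ : ∀ m, γ (g.app z m) = g'.app z (β.app z m) := by
      intro m
      obtain ⟨a, ha⟩ := ((h z).2.1 (s (g.app z m) - m)).1 (by
        rw [map_sub, sub_eq_zero]; exact LinearMap.congr_fun hs _)
      have h1 : g'.app z (β.app z (s (g.app z m) - m)) = 0 := by
        rw [← ha, hα]
        exact ((h' z).2.1 _).2 ⟨_, rfl⟩
      rw [map_sub, map_sub, sub_eq_zero] at h1
      exact h1
    refine ⟨LinearEquiv.ofBijective γ ⟨?_, fun c' => ?_⟩, hγ⟩
    · rw [injective_iff_map_eq_zero]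
      intro n hn
      obtain ⟨m, rfl⟩ := (h z).2.2 n
      rw [hγ] at hn
      obtain ⟨a', ha'⟩ := ((h' z).2.1 _).1 hn
      obtain ⟨a, rfl⟩ := (α.app z).surjective a'
      rw [← hα] at ha'
      rw [← (β.app z).injective ha']
      exact ((h z).2.1 _).2 ⟨_, rfl⟩
    · obtain ⟨b', rfl⟩ := (h' z).2.2 c'
      refine ⟨g.app z ((β.app z).symm b'), ?_⟩
      rw [hγ, LinearEquiv.apply_symm_apply]
  choose γ hγ using key
  refine ⟨α, β, ⟨γ, fun {a b} hab n => ?_⟩, hα, hγ⟩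
  obtain ⟨m, rfl⟩ := (h a).2.2 n
  rw [← g.comm, hγ, hγ, β.comm, g'.comm]

theorem exists_isShortExact_of_iso {A B C A' B' C' : DigraphRep k Ω} (α : Iso A A')
    (β : Iso B B') (γ : Iso C C') {f : Hom A B} {g : Hom B C} (h : IsShortExact f g) :
    ∃ (f' : Hom A' B') (g' : Hom B' C'), IsShortExact f' g' := by
  refine ⟨(α.symm.hom.comp f).comp β.hom, (β.symm.hom.comp g).comp γ.hom, fun z => ⟨?_, ?_, ?_⟩⟩
  · exact (β.app z).injective.comp ((h z).1.comp (α.app z).symm.injective)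
  · intro m
    obtain ⟨b, rfl⟩ := (β.app z).surjective m
    have h1 : ((β.symm.hom.comp g).comp γ.hom).app z (β.app z b) = γ.app z (g.app z b) := by
      simp [Hom.comp, Iso.hom, Iso.symm]
    rw [h1, map_eq_zero_iff _ (γ.app z).injective, (h z).2.1 b]
    constructor
    · rintro ⟨a, rfl⟩
      exact ⟨α.app z a, by simp [Hom.comp, Iso.hom, Iso.symm]⟩
    · rintro ⟨a, ha⟩
      exact ⟨(α.app z).symm a, (β.app z).injective ha⟩
  · exact (γ.app z).surjective.comp ((h z).2.2.comp (β.app z).symm.surjective)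

theorem IsReflected.exists_isShortExact (hG : G.Connected) (hN : ∀ z, ∃ w, G.Adj z w)
    {b c : V → ℤ} {y z : V} (ha : IsPersistent G a x) (hb : IsPersistent G b y)
    (hc : IsPersistent G c z) {i j : ℕ}
    (h0 : ∀ Ω : Digraph V, IsOrientationAt G Ω 0 x →
      ∃ (A B C : DigraphRep k Ω) (f : Hom A B) (g : Hom B C), IsReflected G a 0 x A ∧
        IsReflected G b i y B ∧ IsReflected G c j z C ∧ IsShortExact f g) (t : ℕ) :
    ∀ Ω : Digraph V, IsOrientationAt G Ω t x →
      ∃ (A B C : DigraphRep k Ω) (f : Hom A B) (g : Hom B C), IsReflected G a t x A ∧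
        IsReflected G b (t + i) y B ∧ IsReflected G c (t + j) z C ∧ IsShortExact f g := by
  induction t with
  | zero => simpa using h0
  | succ t ih =>
    intro Ω hΩ
    obtain ⟨Ω', hop⟩ := exists_opposite Ω
    have hΩ' := hΩ.pred hop
    obtain ⟨A, B, C, f, g, hA, hB, hC, hfg⟩ := ih Ω' hΩ'
    obtain ⟨A', ⟨RA⟩, hA'⟩ := hA.exists_up hG hN ha hop.symm
    obtain ⟨B', ⟨RB⟩, hB'⟩ := hB.exists_up hG hN hb hop.symm
    obtain ⟨C', ⟨RC⟩, hC'⟩ := hC.exists_up hG hN hc hop.symm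
    obtain ⟨f', g', h'⟩ :=
      Reflection.isShortExact_up hΩ'.bipartite hop.symm hN RA RB RC f g hfg
    refine ⟨A', B', C', f', g', hA', ?_, ?_, h'⟩
    · rwa [Nat.add_right_comm]
    · rwa [Nat.add_right_comm]

/-- A short exact sequence of three families of reflected representations exists and is unique
at every stage, if this holds at the initial stage. -/
theorem existsUniqueShortExact_of_zero (hG : G.Connected) (hN : ∀ z, ∃ w, G.Adj z w)
    {b c : V → ℤ} {y z : V} (ha : IsPersistent G a x) (hb : IsPersistent G b y)
    (hc : IsPersistent G c z) (ra : IsRigidVec k G a x) (rb : IsRigidVec k G b y)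
    (rc : IsRigidVec k G c z) {i j : ℕ}
    (hline : ∀ (Ω : Digraph V) (A B : DigraphRep k Ω), IsReflected G a 0 x A →
      IsReflected G b i y B → HomLine A B)
    (h0 : ∀ Ω : Digraph V, IsOrientationAt G Ω 0 x →
      ∃ (A B C : DigraphRep k Ω) (f : Hom A B) (g : Hom B C), IsReflected G a 0 x A ∧
        IsReflected G b i y B ∧ IsReflected G c j z C ∧ IsShortExact f g)
    (t : ℕ) (hΩ : IsOrientationAt G Ω t x) :
    ExistsUniqueShortExact (k := k) (Ω := Ω) (IsReflected G a t x) (IsReflected G b (t + i) y)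
      (IsReflected G c (t + j) z) := by
  have ua := IsReflected.nonempty_iso hG hN ha ra t Ω
  have ub := IsReflected.nonempty_iso hG hN hb rb (t + i) Ω
  have uc := IsReflected.nonempty_iso hG hN hc rc (t + j) Ω
  obtain ⟨A, B, C, f, g, hA, hB, hC, hfg⟩ :=
    IsReflected.exists_isShortExact hG hN ha hb hc h0 t Ω hΩ
  refine ⟨⟨A, hA⟩, ⟨B, hB⟩, ⟨C, hC⟩, fun A' B' C' hA' hB' hC' => ?_,
    fun A B C A' B' C' hA hB hC hA' hB' hC' f g f' g' h h' => ?_⟩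
  · obtain ⟨α⟩ := ua A A' hA hA'
    obtain ⟨β⟩ := ub B B' hB hB'
    obtain ⟨γ⟩ := uc C C' hC hC'
    exact exists_isShortExact_of_iso α β γ hfg
  · obtain ⟨α⟩ := ua A A' hA hA'
    obtain ⟨β⟩ := ub B B' hB hB'
    exact seqIso_of_homLine α β hA.indecomposable.1
      (IsReflected.homLine hG hN ha hb hline t Ω A' B' hA' hB') f g f' g' h h'

end Reflected

/-! ### The initial stages -/

section Initial

variable {k : Type u} [Field k] {V : Type v} {Ω Ω' : Digraph V}
variable {G : SimpleGraph V}

open DigraphRep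

theorem DigraphRep.HasDimVector.nonempty_linearEquiv {M M' : DigraphRep k Ω} {d : V → ℤ}
    (h : M.HasDimVector d) (h' : M'.HasDimVector d) (z : V) :
    Nonempty (M.space z ≃ₗ[k] M'.space z) := by
  have := (h z).1
  have := (h' z).1
  exact FiniteDimensional.nonempty_linearEquiv_of_finrank_eq
    (by exact_mod_cast (h z).2.trans (h' z).2.symm)

open Classical in
/-- For a proposition `p`, the space `PLift p → k` is `k` if `p` holds and zero otherwise. The
canonical map between two such spaces is the identity of `k` if both propositions hold. -/
noncomputable def transfer (k : Type u) [Field k] (p q : Prop) :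
    (PLift p → k) →ₗ[k] (PLift q → k) where
  toFun f _ := if h : p then f ⟨h⟩ else 0
  map_add' f g := by
    funext _
    simp only [Pi.add_apply]
    split_ifs <;> simp
  map_smul' c f := by
    funext _
    simp only [Pi.smul_apply, RingHom.id_apply]
    split_ifs <;> simp

theorem transfer_apply {p q : Prop} (hp : p) (f : PLift p → k) (hq : PLift q) :
    transfer k p q f hq = f ⟨hp⟩ := dif_pos hp

theorem transfer_apply_of_not {p q : Prop} (hp : ¬ p) (f : PLift p → k)
    (hq : PLift q) : transfer k p q f hq = 0 := dif_neg hp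

/-- The representation that is one-dimensional at the vertices in `s` and zero elsewhere, with
the identity along each arrow inside `s`. -/
noncomputable def thin (k : Type u) [Field k] (Ω : Digraph V) (s : Set V) : DigraphRep k Ω where
  space z := PLift (z ∈ s) → k
  map {a b} _ := transfer k (a ∈ s) (b ∈ s)

open Classical in
theorem thin_hasDimVector (s : Set V) :
    (thin k Ω s).HasDimVector fun z => if z ∈ s then 1 else 0 := by
  intro z
  refine ⟨inferInstanceAs (FiniteDimensional k (PLift (z ∈ s) → k)), ?_⟩
  change (Module.finrank k (PLift (z ∈ s) → k) : ℤ) = _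
  rw [Module.finrank_fintype_fun_eq_card]
  by_cases hz : z ∈ s <;> simp [hz]

/-- A thin representation on a star with centre `c` from which all its arrows start
is indecomposable: the summand that is nonzero at `c` contains everything. -/
theorem thin_isIndecomposable {s : Set V} {c : V} (hc : c ∈ s)
    (hs : ∀ b ∈ s, b = c ∨ Ω.Adj c b) : (thin k Ω s).IsIndecomposable := by
  classical
  let one : ∀ z, (thin k Ω s).space z := fun z _ => 1
  have hone : ∀ z (_ : z ∈ s) (m : (thin k Ω s).space z), ∃ r : k, m = r • one z := by
    intro z hz m
    refine ⟨m ⟨hz⟩, funext fun h => ?_⟩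
    change m h = m ⟨hz⟩ * 1
    rw [mul_one]
  have key : ∀ U W : (thin k Ω s).Sub, (∀ z, IsCompl (U.space z) (W.space z)) →
      one c ∈ W.space c → ∀ z, U.space z = ⊥ := by
    intro U W h h1 z
    rw [eq_bot_iff]
    intro m hm
    rw [Submodule.mem_bot]
    by_cases hz : z ∈ s
    · have hz1 : one z ∈ W.space z := by
        rcases hs z hz with rfl | hcz
        · exact h1
        · convert W.map_mem hcz _ h1
          funext hz'
          exact (transfer_apply (k := k) hc (one c) hz').symm
      obtain ⟨r, rfl⟩ := hone z hz m
      exact Submodule.disjoint_def.1 (h z).disjoint _ hm (Submodule.smul_mem _ _ hz1)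
    · funext h
      exact absurd h.down hz
  refine ⟨⟨c, one c, 0, fun h => one_ne_zero (α := k) (congrFun h ⟨hc⟩)⟩, fun U W h => ?_⟩
  obtain ⟨p, hp, q, hq, hpq⟩ := Submodule.mem_sup.1
    ((h c).codisjoint.eq_top ▸ Submodule.mem_top : one c ∈ U.space c ⊔ W.space c)
  obtain ⟨r, rfl⟩ := hone c hc p
  by_cases hr : r = 0
  · rw [hr, zero_smul, zero_add] at hpq
    exact Or.inl (key U W h (hpq ▸ hq))
  · refine Or.inr (key W U (fun z => (h z).symm) ?_)
    have := Submodule.smul_mem _ r⁻¹ hp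
    rwa [smul_smul, inv_mul_cancel₀ hr, one_smul] at this

/-- The morphism between thin representations that is the identity at the common vertices. -/
noncomputable def thinHom {s s' : Set V}
    (h : ∀ a b, Ω.Adj a b → a ∈ s → b ∈ s' → (b ∈ s ↔ a ∈ s')) :
    Hom (thin k Ω s) (thin k Ω s') where
  app z := transfer k (z ∈ s) (z ∈ s')
  comm := fun {a b} hab (m : PLift (a ∈ s) → k) => by
    funext hb
    change transfer k (b ∈ s) (b ∈ s') (transfer k (a ∈ s) (b ∈ s) m) hb =
      transfer k (a ∈ s') (b ∈ s') (transfer k (a ∈ s) (a ∈ s') m) hb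
    by_cases ha : a ∈ s
    · by_cases hb' : b ∈ s
      · have ha' := (h a b hab ha hb.down).1 hb'
        rw [transfer_apply hb', transfer_apply ha', transfer_apply ha, transfer_apply ha]
      · have ha' := fun h' => hb' ((h a b hab ha hb.down).2 h')
        rw [transfer_apply_of_not hb', transfer_apply_of_not ha']
    · have h0 : ∀ q : Prop, transfer k (a ∈ s) q m = 0 := fun q =>
        funext fun h => transfer_apply_of_not ha m h
      rw [h0, h0, map_zero, map_zero]

/-- A sink `b` of a thin representation gives a one-dimensional subrepresentation, and the
quotient is thin as well. -/
theorem exists_thin_isShortExact {b : V} (hb : IsSink Ω b) {s : Set V} (hbs : b ∉ s) :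
    ∃ (f : Hom (thin k Ω {b}) (thin k Ω (insert b s)))
      (g : Hom (thin k Ω (insert b s)) (thin k Ω s)), IsShortExact f g := by
  classical
  refine ⟨thinHom fun a c hac ha _ => absurd (Set.mem_singleton_iff.1 ha ▸ hac) (hb c),
    thinHom fun a c hac ha hc => ⟨fun _ => ha.resolve_left fun h => hb c (h ▸ hac),
      fun _ => Or.inr hc⟩, fun z => ?_⟩
  change Function.Injective (transfer k (z ∈ ({b} : Set V)) (z ∈ insert b s)) ∧
    Function.Exact (transfer k (z ∈ ({b} : Set V)) (z ∈ insert b s))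
      (transfer k (z ∈ insert b s) (z ∈ s)) ∧
    Function.Surjective (transfer k (z ∈ insert b s) (z ∈ s))
  have i₁ : z ∈ s → z ∈ insert b s := Or.inr
  have i₂ : z ∈ ({b} : Set V) → z ∈ insert b s := Or.inl
  have i₃ : z ∈ insert b s → z ∉ s → z ∈ ({b} : Set V) := Or.resolve_right
  have i₄ : z ∈ s → z ∉ ({b} : Set V) := fun hz h => hbs (Set.mem_singleton_iff.1 h ▸ hz)
  refine ⟨fun m m' h => ?_, fun m => ⟨fun h => ?_, ?_⟩, fun m => ?_⟩
  · funext hz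
    have := congrFun h ⟨i₂ hz.down⟩
    rwa [transfer_apply hz.down, transfer_apply hz.down] at this
  · by_cases hz : z ∈ s
    · refine ⟨0, funext fun hz' => ?_⟩
      have := congrFun h ⟨hz⟩
      rw [transfer_apply (i₁ hz)] at this
      rw [map_zero]
      exact this.symm
    · refine ⟨fun hz' => m ⟨i₂ hz'.down⟩, funext fun hz' => ?_⟩
      rw [transfer_apply (i₃ hz'.down hz)]
  · rintro ⟨m, rfl⟩
    funext hz
    rw [transfer_apply (i₁ hz.down), transfer_apply_of_not (i₄ hz.down)]
    rfl
  · by_cases hz : z ∈ s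
    · exact ⟨fun _ => m ⟨hz⟩, funext fun hz' => transfer_apply (i₁ hz) _ _⟩
    · exact ⟨0, funext fun hz' => absurd hz'.down hz⟩

theorem IsOrientationAt.of_adj {t : ℕ} {x y : V} (h : IsOrientationAt G Ω (t + 1) x)
    (hxy : G.Adj x y) : IsOrientationAt G Ω t y where
  bipartite := h.bipartite
  sink ht := h.bipartite.isSink_of_adj (h.source (by grind)) hxy
  source ht := h.bipartite.isSource_of_adj (h.sink (by grind)) hxy

theorem IsOrientationAt.succ_of_adj {t : ℕ} {x y : V} (h : IsOrientationAt G Ω t y)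
    (hxy : G.Adj x y) : IsOrientationAt G Ω (t + 1) x where
  bipartite := h.bipartite
  sink ht := h.bipartite.isSink_of_adj (h.source (by grind)) hxy.symm
  source ht := h.bipartite.isSource_of_adj (h.sink (by grind)) hxy.symm

variable [G.LocallyFinite]

theorem isPersistent_vertexVec (hG : G.Connected) (h3 : G.IsRegularOfDegree 3)
    (hN : ∀ z, ∃ w, G.Adj z w) (x : V) : IsPersistent G (vertexVec x) x := fun Ω t h =>
  exists_ne_zero_of_sinkSum_ne_zero (by
    rw [(sinkSum_vertexVec_iterReflection hG h3 hN h).2]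
    exact_mod_cast (Nat.fib_pos.2 (by omega)).ne')

theorem isPersistent_edge (hG : G.Connected) (h3 : G.IsRegularOfDegree 3)
    (hN : ∀ z, ∃ w, G.Adj z w) {x y : V} (hxy : G.Adj x y) :
    IsPersistent G (vertexVec x + vertexVec y) x := fun Ω t h =>
  exists_ne_zero_of_sinkSum_ne_zero (by
    rw [(sinkSum_edge_iterReflection hG h3 hN hxy h).2]
    exact_mod_cast (Nat.fib_pos.2 (by omega)).ne')

theorem isRigidVec_vertexVec (x : V) : IsRigidVec k G (vertexVec x) x := by
  intro Ω M M' h h'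
  let e := fun z => (h.dimVector.nonempty_linearEquiv h'.dimVector z).some
  refine ⟨⟨e, fun {a b} hab m => ?_⟩⟩
  by_cases ha : a = x
  · have hb : b ≠ x := by
      rintro rfl
      exact h.orientation.sink_zero b (ha ▸ hab)
    have := h'.dimVector.subsingleton (vertexVec_of_ne hb)
    exact Subsingleton.elim _ _
  · have := h.dimVector.subsingleton (vertexVec_of_ne ha)
    rw [Subsingleton.elim m 0]
    simp

theorem edgeVec_of_ne {x y z : V} (hx : z ≠ x) (hy : z ≠ y) :
    (vertexVec x + vertexVec y) z = 0 := by
  rw [Pi.add_apply, vertexVec_of_ne hx, vertexVec_of_ne hy, add_zero]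

/-- The map along the arrow is injective since the representation is indecomposable, hence
bijective. -/
theorem IsReflected.edge_equiv (hN : ∀ z, ∃ w, G.Adj z w) {x y : V} (hxy : G.Adj x y)
    {M : DigraphRep k Ω} (h : IsReflected G (vertexVec x + vertexVec y) 0 x M) :
    ∃ φ : M.space y ≃ₗ[k] M.space x, ∀ m, φ m = M.tmap y x m := by
  have hΩ := h.orientation.bipartite
  have hx := h.orientation.sink_zero
  have hy := hΩ.isSource_of_adj hx hxy
  have hd := h.dimVector
  have e1 : (vertexVec x + vertexVec y) x = 1 := by
    rw [Pi.add_apply, vertexVec_self, vertexVec_of_ne hxy.ne, add_zero]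
  have e2 : (vertexVec x + vertexVec y) y = 1 := by
    rw [Pi.add_apply, vertexVec_self, vertexVec_of_ne hxy.ne', zero_add]
  have hinj : Function.Injective (M.tmap y x) := by
    have := h.indecomposable.outMap_injective hΩ hN
      ⟨x, hx, hd.nontrivial (z := x) (e1.trans_ne one_ne_zero)⟩ hy
    rw [injective_iff_map_eq_zero]
    intro m hm
    apply this
    rw [map_zero]
    funext w
    by_cases hw : (w : V) = x
    · obtain ⟨w, hw'⟩ := w
      subst hw
      exact hm
    · have := hd.subsingleton (edgeVec_of_ne hw (show (w : V) ≠ y from w.2.ne'))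
      exact Subsingleton.elim _ _
  have := (hd x).1
  have := (hd y).1
  exact ⟨LinearMap.linearEquivOfInjective _ hinj
    (by exact_mod_cast (hd y).2.trans ((e2.trans e1.symm).trans (hd x).2.symm)), fun m => rfl⟩

theorem isRigidVec_edge (hN : ∀ z, ∃ w, G.Adj z w) {x y : V} (hxy : G.Adj x y) :
    IsRigidVec k G (vertexVec x + vertexVec y) x := by
  intro Ω M M' h h'
  let e := fun z => (h.dimVector.nonempty_linearEquiv h'.dimVector z).some
  obtain ⟨φ, hφ⟩ := h.edge_equiv hN hxy
  obtain ⟨φ', hφ'⟩ := h'.edge_equiv hN hxy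
  have key : ∀ z, ∃ ε : M.space z ≃ₗ[k] M'.space z, (z ≠ x → ε = e z) ∧
      (z = x → ∀ m, ε (M.tmap y z m) = M'.tmap y z (e y m)) := by
    intro z
    by_cases hz : z = x
    · subst hz
      refine ⟨(φ.symm.trans (e y)).trans φ', fun h => absurd rfl h, fun _ m => ?_⟩
      rw [← hφ, ← hφ']
      simp
    · exact ⟨e z, fun _ => rfl, fun h => absurd h hz⟩
  choose ε h1 h2 using key
  refine ⟨⟨ε, fun {a b} hab m => ?_⟩⟩
  have hax : a ≠ x := by
    rintro rfl
    exact h.orientation.sink_zero b hab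
  by_cases ha : a = y
  · subst ha
    by_cases hb : b = x
    · rw [← M.tmap_of_adj hab, ← M'.tmap_of_adj hab, h1 a hax, h2 b hb]
    · have := h'.dimVector.subsingleton
        (edgeVec_of_ne hb (h.orientation.bipartite.adj hab).ne')
      exact Subsingleton.elim _ _
  · have := h.dimVector.subsingleton (edgeVec_of_ne hax ha)
    rw [Subsingleton.elim m 0]
    simp

open Classical in
theorem sum_vertexVec (x : V) (F : Finset V) :
    ∑ w ∈ F, vertexVec x w = if x ∈ F then 1 else 0 := by
  simp [vertexVec, Finset.sum_pi_single']

open Classical in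
theorem iterReflection_one_vertexVec (hG : G.Connected) (hN : ∀ z, ∃ w, G.Adj z w) {x : V}
    (h : IsOrientationAt G Ω 1 x) (z : V) :
    iterReflection G x (vertexVec x) 1 z = if z = x ∨ G.Adj x z then 1 else 0 := by
  obtain ⟨Ω', hop⟩ := exists_opposite Ω
  have h' := h.pred hop
  have hΩ := h.bipartite
  rcases hΩ.sink_or_source z with hz | hz
  · have hzx : z ≠ x := fun e => hΩ.not_isSource hN hz (e ▸ h.source_one)
    rw [iterReflection_succ_of_isSource hG hN h' _ ((hop.isSource_iff z).2 hz)]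
    simp only [iterReflection]
    rw [sum_vertexVec, vertexVec_of_ne hzx]
    simp [hzx, G.adj_comm]
  · have hxz : ¬ G.Adj x z := fun e => hΩ.not_isSource hN (hΩ.isSink_of_adj h.source_one e) hz
    rw [iterReflection_succ_of_isSink hG hN h' _ ((hop.isSink_iff z).2 hz)]
    by_cases hzx : z = x
    · simp [hzx, iterReflection, vertexVec_self]
    · simp [hzx, hxz, iterReflection, vertexVec_of_ne hzx]

open Classical in
theorem iterReflection_one_edge (hG : G.Connected) (hN : ∀ z, ∃ w, G.Adj z w) {x y : V}
    (hxy : G.Adj x y) (h : IsOrientationAt G Ω 1 x) (z : V) :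
    iterReflection G x (vertexVec x + vertexVec y) 1 z =
      if z = x ∨ G.Adj x z ∧ z ≠ y then 1 else 0 := by
  obtain ⟨Ω', hop⟩ := exists_opposite Ω
  have h' := h.pred hop
  have hΩ := h.bipartite
  have hy := hΩ.isSink_of_adj h.source_one hxy
  rcases hΩ.sink_or_source z with hz | hz
  · have hzx : z ≠ x := fun e => hΩ.not_isSource hN hz (e ▸ h.source_one)
    have hzy : ¬ G.Adj z y := fun e => hΩ.not_isSource hN hy (hΩ.isSource_of_adj hz e)
    rw [iterReflection_succ_of_isSource hG hN h' _ ((hop.isSource_iff z).2 hz)]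
    simp only [iterReflection, Pi.add_apply, Finset.sum_add_distrib]
    rw [sum_vertexVec, sum_vertexVec, vertexVec_of_ne hzx]
    by_cases e : z = y
    · subst e
      simp [hzx, vertexVec_self, hxy.symm]
    · simp [hzx, hzy, e, vertexVec_of_ne e, G.adj_comm]
  · have hxz : ¬ G.Adj x z := fun e => hΩ.not_isSource hN (hΩ.isSink_of_adj h.source_one e) hz
    have hzy : z ≠ y := fun e => hxz (e ▸ hxy)
    rw [iterReflection_succ_of_isSink hG hN h' _ ((hop.isSink_iff z).2 hz)]
    by_cases hzx : z = x
    · subst hzx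
      simp [iterReflection, vertexVec_self, vertexVec_of_ne hzy]
    · simp [hzx, hxz, iterReflection, edgeVec_of_ne hzx hzy]

open Classical in
theorem isReflected_thin {a : V → ℤ} {t : ℕ} {x : V} (hΩ : IsOrientationAt G Ω t x) {s : Set V}
    {c : V} (hc : c ∈ s) (hs : ∀ b ∈ s, b = c ∨ Ω.Adj c b)
    (hd : ∀ z, iterReflection G x a t z = if z ∈ s then 1 else 0) :
    IsReflected G a t x (thin k Ω s) :=
  ⟨hΩ, thin_isIndecomposable hc hs, fun z => by rw [hd]; exact thin_hasDimVector s z⟩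

/-- Morphisms out of the simple representation at a sink `y` into a representation that is
one-dimensional at `y`. -/
theorem homLine_vertexVec {y : V} {A B : DigraphRep k Ω}
    (hA : IsReflected G (vertexVec y) 0 y A) (hB : Module.finrank k (B.space y) = 1) :
    HomLine A B := by
  intro f f' ⟨z, m, hm⟩
  have hz : z = y := by
    by_contra hz
    have := hA.dimVector.subsingleton (vertexVec_of_ne hz)
    rw [Subsingleton.elim m 0, map_zero] at hm
    exact hm rfl
  subst hz
  obtain ⟨c, hc⟩ := (finrank_eq_one_iff_of_nonzero' _ hm).1 hB (f'.app z m)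
  have hA1 : Module.finrank k (A.space z) = 1 := by
    exact_mod_cast (hA.dimVector z).2.trans (vertexVec_self z)
  have hm0 : m ≠ 0 := fun h => hm (by rw [h, map_zero])
  refine ⟨c, fun w n => ?_⟩
  by_cases hw : w = z
  · subst hw
    obtain ⟨d, rfl⟩ := (finrank_eq_one_iff_of_nonzero' m hm0).1 hA1 n
    rw [map_smul, map_smul, ← hc, smul_comm]
  · have := hA.dimVector.subsingleton (vertexVec_of_ne hw)
    rw [Subsingleton.elim n 0, map_zero, map_zero, smul_zero]

end Initial

/-! ### The two exact sequences -/

section Sequences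

variable {k : Type u} [Field k] {V : Type v} {Ω : Digraph V}
variable {G : SimpleGraph V} [G.LocallyFinite]

open DigraphRep

theorem isReflected_thin_singleton {y : V} (hΩ : IsOrientationAt G Ω 0 y) :
    IsReflected G (vertexVec y) 0 y (thin k Ω {y}) := by
  classical
  exact isReflected_thin hΩ rfl (fun b hb => Or.inl hb) fun z => by
    simp [iterReflection, vertexVec, Pi.single_apply]

variable (hG : G.Connected) (h3 : G.IsRegularOfDegree 3) (hN : ∀ z, ∃ w, G.Adj z w) {x y : V}
  (hxy : G.Adj x y)

include hG h3 hN hxy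

/-- The sequence `0 → P_t(y) → P_{t+1}(x) → R_{t+1}(x,y) → 0`. At `t = 0` its terms are the
thin representations on `{y}`, on the star around `x`, and on this star without `y`. -/
theorem existsUnique_P_P_R (t : ℕ) (hΩ : IsOrientationAt G Ω t y) :
    ExistsUniqueShortExact (k := k) (Ω := Ω) (IsReflected G (vertexVec y) t y)
      (IsReflected G (vertexVec x) (t + 1) x)
      (IsReflected G (vertexVec x + vertexVec y) (t + 1) x) := by
  classical
  refine existsUniqueShortExact_of_zero hG hN (isPersistent_vertexVec hG h3 hN y)
    (isPersistent_vertexVec hG h3 hN x) (isPersistent_edge hG h3 hN hxy)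
    (isRigidVec_vertexVec y) (isRigidVec_vertexVec x) (isRigidVec_edge hN hxy)
    (fun Ω A B hA hB => ?_) (fun Ω h => ?_) t hΩ
  · refine homLine_vertexVec hA ?_
    have := (hB.dimVector y).2
    rw [iterReflection_one_vertexVec hG hN hB.orientation, if_pos (Or.inr hxy)] at this
    exact_mod_cast this
  · have h1 := h.succ_of_adj hxy
    have hx := h1.source_one
    have hout := fun z => h.bipartite.adj_of_isSource (b := z) hx
    obtain ⟨f, g, hfg⟩ := exists_thin_isShortExact (k := k) (s := {z | z = x ∨ G.Adj x z ∧ z ≠ y})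
      h.sink_zero (by simp [hxy.ne'])
    have hmem : ∀ z, z ∈ insert y {z | z = x ∨ G.Adj x z ∧ z ≠ y} ↔ z = x ∨ G.Adj x z := by
      intro z
      simp only [Set.mem_insert_iff, Set.mem_ofPred_eq]
      grind
    refine ⟨_, _, _, f, g, isReflected_thin_singleton h, ?_, ?_, hfg⟩
    · refine isReflected_thin (c := x) h1 (by simp) (fun b hb => ?_) fun z => ?_
      · exact ((hmem b).1 hb).imp_right (hout b)
      · rw [iterReflection_one_vertexVec hG hN h1]
        simp only [hmem]
    · refine isReflected_thin (c := x) h1 (by simp) (fun b hb => ?_) fun z => ?_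
      · exact hb.imp_right fun h => hout b h.1
      · rw [iterReflection_one_edge hG hN hxy h1]
        congr

/-- The sequence `0 → P_t(y') → R_{t+1}(x,y) → R_t(y'',x) → 0`. At `t = 0` its terms are the
thin representations on `{y'}`, on `{x, y', y''}`, and on `{x, y''}`. -/
theorem existsUnique_P_R_R {y' y'' : V} (hy' : G.Adj x y') (hy'' : G.Adj x y'')
    (hne : y' ≠ y) (hne' : y' ≠ y'') (hnb : ∀ z, G.Adj x z ∧ z ≠ y ↔ z = y' ∨ z = y'') (t : ℕ)
    (hΩ : IsOrientationAt G Ω t y') :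
    ExistsUniqueShortExact (k := k) (Ω := Ω) (IsReflected G (vertexVec y') t y')
      (IsReflected G (vertexVec x + vertexVec y) (t + 1) x)
      (IsReflected G (vertexVec y'' + vertexVec x) t y'') := by
  classical
  refine existsUniqueShortExact_of_zero (j := 0) hG hN (isPersistent_vertexVec hG h3 hN y')
    (isPersistent_edge hG h3 hN hxy) (isPersistent_edge hG h3 hN hy''.symm)
    (isRigidVec_vertexVec y') (isRigidVec_edge hN hxy) (isRigidVec_edge hN hy''.symm)
    (fun Ω A B hA hB => ?_) (fun Ω h => ?_) t hΩ
  · refine homLine_vertexVec hA ?_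
    have := (hB.dimVector y').2
    rw [iterReflection_one_edge hG hN hxy hB.orientation, if_pos (Or.inr ⟨hy', hne⟩)] at this
    exact_mod_cast this
  · have h1 := h.succ_of_adj hy'
    have hx := h1.source_one
    have hout := fun z => h.bipartite.adj_of_isSource (b := z) hx
    obtain ⟨f, g, hfg⟩ := exists_thin_isShortExact (k := k) (s := {y'', x})
      h.sink_zero (by simp [hy'.ne', hne'])
    refine ⟨_, _, _, f, g, isReflected_thin_singleton h, ?_, ?_, hfg⟩
    · have hmem : ∀ z, z ∈ ({y', y'', x} : Set V) ↔ z = x ∨ G.Adj x z ∧ z ≠ y := by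
        intro z
        simp only [hnb, Set.mem_insert_iff, Set.mem_singleton_iff]
        tauto
      refine isReflected_thin (c := x) h1 (by simp) (fun b hb => ?_) fun z => ?_
      · exact ((hmem b).1 hb).imp_right fun h => hout b h.1
      · rw [iterReflection_one_edge hG hN hxy h1]
        simp only [hmem]
    · refine isReflected_thin (c := x) (h1.of_adj hy'') (by simp) (fun b hb => ?_) fun z => ?_
      · rcases hb with rfl | hb
        · exact Or.inr (hout _ hy'')
        · exact Or.inl hb
      · simp only [iterReflection, Pi.add_apply, vertexVec, Pi.single_apply, Set.mem_insert_iff,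
          Set.mem_singleton_iff]
        have := hy''.ne
        split_ifs <;> grind

end Sequences

theorem IsReflected.sinkDim_vertexVec {k : Type u} [Field k] {V : Type v} {Ω : Digraph V}
    {G : SimpleGraph V} [G.LocallyFinite] (hG : G.Connected) (h3 : G.IsRegularOfDegree 3)
    (hN : ∀ z, ∃ w, G.Adj z w) {x : V} {t : ℕ} {M : DigraphRep k Ω}
    (h : IsReflected G (vertexVec x) t x M) : M.sinkDim = Nat.fib (2 * t + 2) := by
  obtain ⟨h1, h2⟩ := sinkSum_vertexVec_iterReflection hG h3 hN h.orientation
  exact_mod_cast (cast_sinkDim h.dimVector h1).trans h2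

theorem IsReflected.sinkDim_edge {k : Type u} [Field k] {V : Type v} {Ω : Digraph V}
    {G : SimpleGraph V} [G.LocallyFinite] (hG : G.Connected) (h3 : G.IsRegularOfDegree 3)
    (hN : ∀ z, ∃ w, G.Adj z w) {x y : V} (hxy : G.Adj x y) {t : ℕ} {M : DigraphRep k Ω}
    (h : IsReflected G (vertexVec x + vertexVec y) t x M) :
    M.sinkDim = Nat.fib (2 * t + 1) := by
  obtain ⟨h1, h2⟩ := sinkSum_edge_iterReflection hG h3 hN hxy h.orientation
  exact_mod_cast (cast_sinkDim h.dimVector h1).trans h2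

theorem adj_iff_of_degree_three {V : Type v} {G : SimpleGraph V} [G.LocallyFinite]
    (h3 : G.IsRegularOfDegree 3) {x y y' y'' : V} (hy : G.Adj x y) (hy' : G.Adj x y')
    (hy'' : G.Adj x y'') (hne : y ≠ y') (hne' : y ≠ y'') (hne'' : y' ≠ y'') (z : V) :
    G.Adj x z ↔ z = y ∨ z = y' ∨ z = y'' := by
  classical
  have h : ({y, y', y''} : Finset V) = G.neighborFinset x := by
    refine Finset.eq_of_subset_of_card_le (fun w hw => ?_) ?_
    · simp only [Finset.mem_insert, Finset.mem_singleton] at hw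
      rw [SimpleGraph.mem_neighborFinset]
      rcases hw with rfl | rfl | rfl <;> assumption
    · rw [G.card_neighborFinset_eq_degree, h3 x,
        Finset.card_eq_three.2 ⟨_, _, _, hne, hne', hne'', rfl⟩]
  rw [← SimpleGraph.mem_neighborFinset, ← h]
  simp

end FibonacciModules

open FibonacciModules in
theorem proposition4p1 {k : Type u} [Field k] {V : Type v}
    (G : SimpleGraph V) [G.LocallyFinite] (hG : G.IsTree) (h3 : G.IsRegularOfDegree 3)
    (Ω : Digraph V) (hΩ : IsBipartiteOrientation G Ω)
    (x y y' y'' : V) (hy : G.Adj x y) (hy' : G.Adj x y') (hy'' : G.Adj x y'')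
    (hne : y ≠ y') (hne' : y ≠ y'') (hne'' : y' ≠ y'')
    (t : ℕ) (ht : 1 ≤ t) (heven : Even t → IsSink Ω x) (hodd : Odd t → IsSource Ω x) :
    -- the sequence 0 → P_{t-1}(y) → P_t(x) → R_t(x,y) → 0
    DigraphRep.ExistsUniqueShortExact (k := k) (Ω := Ω)
      (IsP G (t - 1) y) (IsP G t x) (IsR G t x y) ∧
    -- the sequence 0 → P_{t-1}(y') → R_t(x,y) → R_{t-1}(y'',x) → 0
    DigraphRep.ExistsUniqueShortExact (k := k) (Ω := Ω)
      (IsP G (t - 1) y') (IsR G t x y) (IsR G (t - 1) y'' x) ∧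
    -- on total dimensions at the sinks they give the Fibonacci equations
    -- f_{2t+2} = f_{2t} + f_{2t+1} and f_{2t+1} = f_{2t} + f_{2t-1}
    (∀ M : DigraphRep k Ω, IsP G (t - 1) y M → M.sinkDim = Nat.fib (2 * t)) ∧
    (∀ M : DigraphRep k Ω, IsP G (t - 1) y' M → M.sinkDim = Nat.fib (2 * t)) ∧
    (∀ M : DigraphRep k Ω, IsP G t x M → M.sinkDim = Nat.fib (2 * t + 2)) ∧
    (∀ M : DigraphRep k Ω, IsR G t x y M → M.sinkDim = Nat.fib (2 * t + 1)) ∧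
    (∀ M : DigraphRep k Ω, IsR G (t - 1) y'' x M → M.sinkDim = Nat.fib (2 * t - 1)) := by
  obtain ⟨n, rfl⟩ : ∃ n, t = n + 1 := ⟨t - 1, by omega⟩
  have hc := hG.connected
  have hN : ∀ z, ∃ w, G.Adj z w := fun z =>
    (G.degree_pos_iff_exists_adj z).1 (by rw [h3 z]; norm_num)
  have ho : IsOrientationAt G Ω (n + 1) x := ⟨hΩ, heven, hodd⟩
  have eP : ∀ t x, (IsP G t x : DigraphRep k Ω → Prop) = IsReflected G (vertexVec x) t x :=
    fun t x => funext fun M => propext isP_iff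
  have eR : ∀ {x y}, G.Adj x y → ∀ t, (IsR G t x y : DigraphRep k Ω → Prop) =
      IsReflected G (vertexVec x + vertexVec y) t x :=
    fun h t => funext fun M => propext (isR_iff h)
  simp only [eP, eR hy, eR hy''.symm, Nat.add_sub_cancel]
  refine ⟨existsUnique_P_P_R hc h3 hN hy n (ho.of_adj hy),
    existsUnique_P_R_R hc h3 hN hy hy' hy'' hne.symm hne'' (fun z => ?_) n (ho.of_adj hy'),
    fun M h => h.sinkDim_vertexVec hc h3 hN, fun M h => h.sinkDim_vertexVec hc h3 hN,
    fun M h => h.sinkDim_vertexVec hc h3 hN, fun M h => h.sinkDim_edge hc h3 hN hy,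
    fun M h => h.sinkDim_edge hc h3 hN hy''.symm⟩
  rw [adj_iff_of_degree_three h3 hy hy' hy'' hne hne' hne'']
  grind
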